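/- Let $a,b,c,d\ge 1$ be integers, let $V=\{(x,y,z)\in\mathbb R^3 : y^a=z^bx^c+x^d\}$ and let $Oz=\{x=y=0\}\subset V$ be the $z$-axis. **Lipschitz stratifications.** Let $X$ be a closed subanalytic subset of an open set $U\subset\mathbb R^n$. A stratification of $X$ is a family $\{S^j\}_{j=l}^m$ of closed subanalytic subsets $X=S^m\supset S^{m-1}\supset\dots\supset S^l\ne\emptyset$ such that each $\mathring S^j=S^j\setminus S^{j-1}$ (with $S^{l-1}=\emptyset$) is a smooth manifold of pure dimension $j$ or empty. Put $d_j(q)=\operatorname{dist}(q,S^j)$ for $l\le j\le m$ and $d_{l-1}\equiv 1$. Fix a constant $\gamma>1$. A chain of $q\in\mathring S^j$ is given by indices $j=j_1>j_2>\dots>j_r=l$, where for $s\ge2$ each $j_s$ is the largest integer in $[l,j_{s-1})$ with $d_{j_s-1}(q)\ge2\gamma^2d_{j_s}(q)$, together with points $q_{j_s}\in\mathring S^{j_s}$ such that $q_{j_1}=q$ and $|q-q_{j_s}|\le\gamma d_{j_s}(q)$. For $q\in\mathring S^j$ let $P_q$ be the orthogonal projection of $\mathbb R^n$ onto $T_q\mathring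 S^j$ and $P_q^\perp=I-P_q$. The stratification is a Lipschitz stratification (relative to $\gamma$) if there is a constant $C>0$ such that for every chain $q=q_{j_1},q_{j_2},\dots,q_{j_r}$, every $2\le k\le r$, and every $q'\in\mathring S^{j_1}$ with $|q-q'|\le\frac1{2\gamma}d_{j_1-1}(q)$, - (L1) $\ |P_q^\perp P_{q_{j_2}}\cdots P_{q_{j_k}}|\le C\,|q-q_{j_2}|/d_{j_k-1}(q)$, - (L2) $\ |(P_q-P_{q'})P_{q_{j_2}}\cdots P_{q_{j_k}}|\le C\,|q-q'|/d_{j_k-1}(q)$, - (L3) $\ |P_q-P_{q'}|\le C\,|q-q'|/d_{j_1-1}(q)$ (also required when $r=1$). We say that $(L)$ holds if the germ at $0$ of $V$, stratified by $V\setminus Oz$ and $Oz$, is Lipschitz stratified: for some open neighbourhood $U$ of $0$ in $\mathbb R^3$, the family $S^1=Oz\cap U\subset S^2=V\cap U$ is a Lipschitz stratification of $V\cap U$. Otherwise we say that $(L)$ fails. **Theorem.** For every $\gamma>1$ the following are true. 1. If $a=1$, then $(L)$ holds. 2. If $a>1$ and $d\le c$, then $(L)$ holds. 3. If $a>1$,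 $d>c$ and $b$ is odd, then $(L)$ fails. 4. If $a>1$, $d>c$, $b$ is even and $d\equiv c+1\pmod 2$, then $(L)$ fails. 5. If $a>1$, $d>c$, $b$ is even, $d\equiv c\pmod 2$ and $a(d-c)>b|d-a|$, then $(L)$ fails. 6. Suppose $a>1$, $d>c$, $b$ is even, $d\equiv c\pmod 2$ and $a(d-c)\le b|d-a|$. - (i) Case $d<a$. - If $c,d$ are even, then $(L)$ fails. - If $c,d$ are odd and $b<2(d-c)$, then $(L)$ fails. - (ii) Case $d\ge a$. - If $a$ is even, then $(L)$ fails. - If $a$ is odd and $c<a$, then $(L)$ fails. - If $a$ is odd, $c\ge a$ and $b<a$: $(L)$ holds when $a(d-c)\le d-a$, and $(L)$ fails when $a(d-c)>d-a$ and $2a(d-c)>db$. - If $a$ is odd, $c\ge a$ and $b\ge 2a$, then $(L)$ holds. - If $a$ is odd, $c\ge a$ and $a\le b<2a$: $(L)$ holds when $a(d-c)\le d$, and $(L)$ fails when $a(d-c)>d$ and $2a(d-c)>db$. (Nothing is asserted in the remaining cases, all under the assumptions of 6: $d<a$ with $c,d$ odd and $b\ge2(d-c)$; and $d\ge a$, $a$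 odd, $c\ge a$, $2a(d-c)\le db$ with either $b<a$ and $a(d-c)>d-a$, or $a\le b<2a$ and $a(d-c)>d$.) -/

import Mathlib

open scoped ContDiff

noncomputable section

/-- Semianalytic subsets of a finite-dimensional real normed space: locally, finite unions of sets
given by finitely many analytic equations and strict inequalities. -/
def IsSemianalytic {F : Type*} [NormedAddCommGroup F] [NormedSpace ℝ F] (A : Set F) : Prop :=
  ∀ p : F, ∃ W : Set F, IsOpen W ∧ p ∈ W ∧ ∃ (N M : ℕ) (f g : Fin N → Fin M → F → ℝ),
    (∀ i k, AnalyticOnNhd ℝ (f i k) W ∧ AnalyticOnNhd ℝ (g i k) W) ∧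
    A ∩ W = {x | x ∈ W ∧ ∃ i, ∀ k, f i k x = 0 ∧ 0 < g i k x}

/-- `A` is a subanalytic subset of the open set `U` of `ℝⁿ`: near each point of `U` it is the
projection of a relatively compact semianalytic subset of some `ℝⁿ × ℝᵏ`. -/
def IsSubanalyticIn {n : ℕ} (U A : Set (EuclideanSpace ℝ (Fin n))) : Prop :=
  A ⊆ U ∧ ∀ p ∈ U, ∃ W : Set (EuclideanSpace ℝ (Fin n)), IsOpen W ∧ p ∈ W ∧
    ∃ (k : ℕ) (B : Set (EuclideanSpace ℝ (Fin n) × EuclideanSpace ℝ (Fin k))),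
      IsSemianalytic B ∧ Bornology.IsBounded B ∧ A ∩ W = Prod.fst '' B

/-- `M ⊆ ℝⁿ` is a smooth (embedded) submanifold of pure dimension `k`, or empty: near each of its
points it is the zero set of a smooth submersion onto `ℝᵐ`, where `m + k = n`. -/
def IsSmoothSubmanifold {n : ℕ} (M : Set (EuclideanSpace ℝ (Fin n))) (k : ℕ) : Prop :=
  ∀ q ∈ M, ∃ W : Set (EuclideanSpace ℝ (Fin n)), IsOpen W ∧ q ∈ W ∧
    ∃ (m : ℕ) (g : EuclideanSpace ℝ (Fin n) → EuclideanSpace ℝ (Fin m)),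
      m + k = n ∧ ContDiffOn ℝ ∞ g W ∧ Function.Surjective (fderiv ℝ g q) ∧
      M ∩ W = {x | x ∈ W ∧ g x = 0}

/-- The tangent space `T_q M`, spanned by the velocities at `q` of curves lying in `M`.
(If `M` is a smooth submanifold, these velocities already form a linear subspace.) -/
def tangentSpaceAt {n : ℕ} (M : Set (EuclideanSpace ℝ (Fin n))) (q : EuclideanSpace ℝ (Fin n)) :
    Submodule ℝ (EuclideanSpace ℝ (Fin n)) :=
  Submodule.span ℝ {v | ∃ u : ℝ → EuclideanSpace ℝ (Fin n),
    u 0 = q ∧ (∀ᶠ t in nhds (0 : ℝ), u t ∈ M) ∧ HasDerivAt u v 0}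

/-- The orthogonal projection `P_q` of `ℝⁿ` onto `T_q M`. -/
def tangentProj {n : ℕ} (M : Set (EuclideanSpace ℝ (Fin n))) (q : EuclideanSpace ℝ (Fin n)) :
    EuclideanSpace ℝ (Fin n) →L[ℝ] EuclideanSpace ℝ (Fin n) :=
  (tangentSpaceAt M q).starProjection

/-- The orthogonal projection `P_q^⊥ = I - P_q` onto the normal space `(T_q M)^⊥`. -/
def normalProj {n : ℕ} (M : Set (EuclideanSpace ℝ (Fin n))) (q : EuclideanSpace ℝ (Fin n)) :
    EuclideanSpace ℝ (Fin n) →L[ℝ] EuclideanSpace ℝ (Fin n) :=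
  1 - tangentProj M q

/-- `S^j \ S^{j-1}` for a filtration starting at the index `l`, where `S^{l-1} = ∅`. -/
def openStratum {n : ℕ} (S : ℕ → Set (EuclideanSpace ℝ (Fin n))) (l j : ℕ) :
    Set (EuclideanSpace ℝ (Fin n)) :=
  S j \ (if j ≤ l then ∅ else S (j - 1))

/-- The distance `d_j(q)` from `q` to `S^j`. -/
def skelDist {n : ℕ} (S : ℕ → Set (EuclideanSpace ℝ (Fin n))) (j : ℕ)
    (q : EuclideanSpace ℝ (Fin n)) : ℝ :=
  Metric.infDist q (S j)

/-- The quantity `d_{j-1}(q)` for an index `j ≥ l`, with the convention `d_{l-1} ≡ 1`. -/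
def skelDistPred {n : ℕ} (S : ℕ → Set (EuclideanSpace ℝ (Fin n))) (l j : ℕ)
    (q : EuclideanSpace ℝ (Fin n)) : ℝ :=
  if j ≤ l then 1 else skelDist S (j - 1) q

/-- `X = S^m ⊇ S^{m-1} ⊇ ⋯ ⊇ S^l ≠ ∅` is a stratification of the subset `X` of the open set `U`:
every `S^j` is a subanalytic subset of `U`, closed in `U`, and `S^j \ S^{j-1}` is a smooth manifold
of pure dimension `j` or empty. Only the values `S j` with `l ≤ j ≤ m` matter. -/
structure IsStratification {n : ℕ} (U X : Set (EuclideanSpace ℝ (Fin n))) (l m : ℕ)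
    (S : ℕ → Set (EuclideanSpace ℝ (Fin n))) : Prop where
  isOpen : IsOpen U
  le : l ≤ m
  top_eq : S m = X
  bot_nonempty : (S l).Nonempty
  mono : ∀ j, l ≤ j → j < m → S j ⊆ S (j + 1)
  subanalytic : ∀ j, l ≤ j → j ≤ m → IsSubanalyticIn U (S j)
  closed : ∀ j, l ≤ j → j ≤ m → ∃ F, IsClosed F ∧ S j = F ∩ U
  smooth : ∀ j, l ≤ j → j ≤ m → IsSmoothSubmanifold (openStratum S l j) j

/-- `q = p 1, p 2, …, p r` is a chain of `q`, with indices `j 1 > j 2 > ⋯ > j r = l`, relative to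
the constant `γ`. (The values of `j` and `p` outside `{1, …, r}` are irrelevant.) -/
structure IsMostowskiChain {n : ℕ} (γ : ℝ) (l m : ℕ) (S : ℕ → Set (EuclideanSpace ℝ (Fin n)))
    (q : EuclideanSpace ℝ (Fin n)) (r : ℕ) (j : ℕ → ℕ) (p : ℕ → EuclideanSpace ℝ (Fin n)) :
    Prop where
  one_le : 1 ≤ r
  top_le : j 1 ≤ m
  last : j r = l
  decreasing : ∀ s, 1 ≤ s → s < r → l ≤ j (s + 1) ∧ j (s + 1) < j s
  gap : ∀ s, 1 ≤ s → s < r →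
    2 * γ ^ 2 * skelDist S (j (s + 1)) q ≤ skelDistPred S l (j (s + 1)) q
  largest : ∀ s, 1 ≤ s → s < r → ∀ i, j (s + 1) < i → i < j s →
    ¬ 2 * γ ^ 2 * skelDist S i q ≤ skelDistPred S l i q
  first : p 1 = q
  mem : ∀ s, 1 ≤ s → s ≤ r → p s ∈ openStratum S l (j s)
  near : ∀ s, 1 ≤ s → s ≤ r → ‖q - p s‖ ≤ γ * skelDist S (j s) q

/-- The product `P_{q_{j_2}} ⋯ P_{q_{j_k}}` along a chain (`List.range' 2 (k - 1)` is the list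
`[2, …, k]`, and the product is composition). -/
def chainProj {n : ℕ} (l : ℕ) (S : ℕ → Set (EuclideanSpace ℝ (Fin n))) (j : ℕ → ℕ)
    (p : ℕ → EuclideanSpace ℝ (Fin n)) (k : ℕ) :
    EuclideanSpace ℝ (Fin n) →L[ℝ] EuclideanSpace ℝ (Fin n) :=
  ((List.range' 2 (k - 1)).map fun s => tangentProj (openStratum S l (j s)) (p s)).prod

/-- Lipschitz stratifications in the sense of Mostowski: the three conditions (L1), (L2), (L3),
with a uniform constant `C`, for all chains relative to `γ`. -/
def IsLipschitzStratification {n : ℕ} (γ : ℝ) (U X : Set (EuclideanSpace ℝ (Fin n))) (l m : ℕ)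
    (S : ℕ → Set (EuclideanSpace ℝ (Fin n))) : Prop :=
  IsStratification U X l m S ∧
  ∃ C : ℝ, 0 < C ∧
    ∀ (q : EuclideanSpace ℝ (Fin n)) (r : ℕ) (j : ℕ → ℕ) (p : ℕ → EuclideanSpace ℝ (Fin n)),
      IsMostowskiChain γ l m S q r j p →
      (∀ k, 2 ≤ k → k ≤ r →
        ‖normalProj (openStratum S l (j 1)) q * chainProj l S j p k‖
          ≤ C * ‖q - p 2‖ / skelDistPred S l (j k) q) ∧
      ∀ q' ∈ openStratum S l (j 1), ‖q - q'‖ ≤ 1 / (2 * γ) * skelDistPred S l (j 1) q →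
        (∀ k, 2 ≤ k → k ≤ r →
          ‖(tangentProj (openStratum S l (j 1)) q - tangentProj (openStratum S l (j 1)) q')
              * chainProj l S j p k‖
            ≤ C * ‖q - q'‖ / skelDistPred S l (j k) q) ∧
        ‖tangentProj (openStratum S l (j 1)) q - tangentProj (openStratum S l (j 1)) q'‖
          ≤ C * ‖q - q'‖ / skelDistPred S l (j 1) q

/-- The real algebraic surface `y^a = z^b x^c + x^d`, where `(x, y, z) = (v 0, v 1, v 2)`. -/
def surfaceV (a b c d : ℕ) : Set (EuclideanSpace ℝ (Fin 3)) :=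
  {v | v 1 ^ a = v 2 ^ b * v 0 ^ c + v 0 ^ d}

/-- The `z`-axis. -/
def axisOz : Set (EuclideanSpace ℝ (Fin 3)) := {v | v 0 = 0 ∧ v 1 = 0}

/-- The filtration `S² = V ∩ U ⊇ S¹ = Oz ∩ U`, whose strata are `V - Oz` and `Oz` in `U`. -/
def surfaceFiltration (a b c d : ℕ) (U : Set (EuclideanSpace ℝ (Fin 3))) (j : ℕ) :
    Set (EuclideanSpace ℝ (Fin 3)) :=
  if j ≤ 1 then axisOz ∩ U else surfaceV a b c d ∩ U

/-- Mostowski `(L)`-regularity of `(V - Oz, Oz)` as a germ at the origin: in some open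
neighbourhood of `0` it is a Lipschitz stratification. -/
def MostowskiRegular (γ : ℝ) (a b c d : ℕ) : Prop :=
  ∃ U : Set (EuclideanSpace ℝ (Fin 3)), IsOpen U ∧ 0 ∈ U ∧
    IsLipschitzStratification γ U (surfaceV a b c d ∩ U) 1 2 (surfaceFiltration a b c d U)

end

/-!
Only chains `q, q₂` with `q` on the surface and `q₂` on the axis carry information, so with `N` a
normal vector at `q = (x, y, z)` and `ρ = √(x² + y²)`, Mostowski's conditions near the origin say:
`|N_z| = O(ρ |N|)` (L1), `N_z N / |N|²` varies by `O(|q - q'|)` between points with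
`|q - q'| ≤ ρ / 2γ` (L2), and the normal direction varies by `O(|q - q'| / ρ)` (L3). The reduction
rests on `tangentSpaceAt_eq_orthogonal_gradient`; `MostowskiRegular.exists_bounds` and
`mostowskiRegular_of_normalField` are its two directions.

Failure is seen on explicit curves. Write `e = d - c`. If the right-hand side vanishes along a curve
`z ^ b = -x ^ e` off the axis, (L1) fails there (`not_mostowskiRegular_of_zeroCurve`). Otherwise the
test curve is `z ^ b = x ^ e`, parametrised by `x = s ^ (a * b)`, `z = s ^ (a * e)`,
`y = 2 ^ (1 / a) * s ^ (d * b)`: there `|N_x|`, `|N_y|`, `|N_z|` are monomials in `s`, of orders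
`D - a * b`, `D - d * b`, `D - a * e` with `D = a * b * d`, and comparing orders shows that (L1)
fails when `b * |d - a| < a * e` (`not_mostowskiRegular_of_curve`). When it does not, (L2) fails
between the curve and its mirror image in `x` or in `y`, if the surface has that symmetry, or
between the curve and the section `z = 0`, where `N_z = 0`, if the curve is close enough to it; all
this is in `MostowskiRegular.exists_curve_bounds`. For `c < a < d` the curve `x = y` violates (L1).

Regularity is proved by exhibiting a normal field with the required Lipschitz bounds. For `a = 1`
the gradient itself is one, and for `d ≤ c` the surface is `y ^ a = x ^ d * unit`, whose normal
direction is a smooth function of the point and of `y / x` (or `x / y`)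
(`mostowskiRegular_of_quotient`). In the remaining cases `a` is odd, `b` and `e` are even and
`a ≤ c`, so that the surface is a graph `y = g(x, z)` with `|g| = (|x| ^ c * f) ^ (1 / a)`,
`f = z ^ b + |x| ^ e`. Its second derivatives are controlled by the three inequalities `|g| ≤ |x|`,
`|g| |z| ^ (b - 1) ≤ f |x|` and `|g| |z| ^ (b - 2) ≤ f`, which, raised to the power `a * b * e`,
compare monomials in `|x| ^ e ≤ f` and `z ^ b ≤ f`. The last one needs `2 * a ≤ b` or
`2 * a * e ≤ b * d`, which holds in each of the cases at hand
(`mostowskiRegular_of_branch`).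
-/

/-! ### Tangent spaces and projections -/

/-- The tangent space of a regular level set is the orthogonal complement of the gradient. The
curves realising all vectors orthogonal to the gradient come from the implicit function theorem. -/
lemma tangentSpaceAt_eq_orthogonal_gradient {n : ℕ} {F : EuclideanSpace ℝ (Fin n) → ℝ}
    {N q : EuclideanSpace ℝ (Fin n)} {M W : Set (EuclideanSpace ℝ (Fin n))}
    (hF : HasStrictFDerivAt F (innerSL ℝ N) q) (hN : N ≠ 0) (hW : W ∈ nhds q)
    (hM : M ∩ W = {v | v ∈ W ∧ F v = 0}) (hq : q ∈ M) :
    tangentSpaceAt M q = (Submodule.span ℝ {N})ᗮ := by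
  have hFM : ∀ v ∈ W, (v ∈ M ↔ F v = 0) := by
    intro v hv
    have := Set.ext_iff.1 hM v
    simp only [Set.mem_inter_iff, Set.mem_ofPred_eq, hv, and_true, true_and] at this
    exact this
  apply le_antisymm
  · refine Submodule.span_le.2 ?_
    rintro v ⟨u, hu0, huM, hu⟩
    rw [SetLike.mem_coe, Submodule.mem_orthogonal_singleton_iff_inner_right]
    have hcomp : HasDerivAt (fun t => F (u t)) (innerSL ℝ N v) 0 := by
      have hF' : HasFDerivAt F (innerSL ℝ N) (u 0) := by rw [hu0]; exact hF.hasFDerivAt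
      exact hF'.comp_hasDerivAt 0 hu
    have hz : (fun t => F (u t)) =ᶠ[nhds 0] fun _ => (0 : ℝ) := by
      have hW' : ∀ᶠ t in nhds (0 : ℝ), u t ∈ W := by
        apply hu.continuousAt.eventually_mem
        rw [hu0]; exact hW
      filter_upwards [huM, hW'] with t h1 h2
      exact (hFM _ h2).1 h1
    exact hcomp.unique ((hasDerivAt_const (0 : ℝ) (0 : ℝ)).congr_of_eventuallyEq hz)
  · intro v hv
    rw [Submodule.mem_orthogonal_singleton_iff_inner_right] at hv
    apply Submodule.subset_span
    have hsurj : (innerSL ℝ N : EuclideanSpace ℝ (Fin n) →L[ℝ] ℝ).range = ⊤ := by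
      rw [LinearMap.range_eq_top]
      intro r
      refine ⟨(r / ‖N‖ ^ 2) • N, ?_⟩
      have : ‖N‖ ≠ 0 := norm_ne_zero_iff.2 hN
      simp
      field_simp
    have hker : v ∈ (innerSL ℝ N : EuclideanSpace ℝ (Fin n) →L[ℝ] ℝ).ker := hv
    have hF0 : F q = 0 := (hFM q (mem_of_mem_nhds hW)).1 hq
    let w : (innerSL ℝ N : EuclideanSpace ℝ (Fin n) →L[ℝ] ℝ).ker := ⟨v, hker⟩
    let u : ℝ → EuclideanSpace ℝ (Fin n) :=
      fun t => hF.implicitFunction F _ hsurj (F q) (t • w)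
    have hlin : HasDerivAt (fun t : ℝ => t • w) w 0 := by
      simpa only [one_smul, id] using (hasDerivAt_id (0 : ℝ)).smul_const w
    have hu0 : u 0 = q := by
      simp only [u, zero_smul]
      exact hF.implicitFunction_apply_image hsurj
    have hu : HasDerivAt u v 0 := by
      have h1 := (hF.to_implicitFunction hsurj).hasFDerivAt
      rw [← zero_smul ℝ w] at h1
      exact h1.comp_hasDerivAt 0 hlin
    refine ⟨u, hu0, ?_, hu⟩
    have hW' : ∀ᶠ t in nhds (0 : ℝ), u t ∈ W := by
      apply hu.continuousAt.eventually_mem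
      rw [hu0]; exact hW
    have hlim : Filter.Tendsto (fun t : ℝ => (F q, t • w)) (nhds 0) (nhds (F q, 0)) := by
      have : ContinuousAt (fun t : ℝ => (F q, t • w)) 0 :=
        continuousAt_const.prodMk hlin.continuousAt
      simpa only [ContinuousAt, zero_smul] using this
    filter_upwards [hW', hlim.eventually (hF.map_implicitFunction_eq hsurj)] with t h1 h2
    rw [hFM _ h1]
    exact h2.trans hF0

/-- The orthogonal projection onto the line spanned by `N`. -/
noncomputable def lineProj {n : ℕ} (N : EuclideanSpace ℝ (Fin n)) :
    EuclideanSpace ℝ (Fin n) →L[ℝ] EuclideanSpace ℝ (Fin n) :=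
  (Submodule.span ℝ {N}).starProjection

lemma lineProj_apply {n : ℕ} (N v : EuclideanSpace ℝ (Fin n)) :
    lineProj N v = (inner ℝ N v / ‖N‖ ^ 2) • N := by
  rw [lineProj, Submodule.starProjection_singleton]; rfl

lemma lineProj_smul {n : ℕ} {r : ℝ} (hr : r ≠ 0) (N : EuclideanSpace ℝ (Fin n)) :
    lineProj (r • N) = lineProj N := by
  simp only [lineProj, Submodule.span_singleton_smul_eq hr.isUnit]

lemma norm_inv_norm_smul_sub_le {n : ℕ} {u v : EuclideanSpace ℝ (Fin n)} (hu : 1 ≤ ‖u‖)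
    (hv : 1 ≤ ‖v‖) : ‖‖u‖⁻¹ • u - ‖v‖⁻¹ • v‖ ≤ 2 * ‖u - v‖ := by
  have hu' : 0 < ‖u‖ := by linarith
  have hv' : 0 < ‖v‖ := by linarith
  have h1 : ‖u‖⁻¹ • u - ‖v‖⁻¹ • v = ‖u‖⁻¹ • (u - v) + (‖u‖⁻¹ - ‖v‖⁻¹) • v := by
    rw [smul_sub, sub_smul]; abel
  have h2 : ‖u‖⁻¹ ≤ 1 := inv_le_one_of_one_le₀ hu
  have h3 : |‖u‖⁻¹ - ‖v‖⁻¹| * ‖v‖ ≤ ‖u - v‖ := by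
    have : |‖u‖⁻¹ - ‖v‖⁻¹| * ‖v‖ = ‖u‖⁻¹ * |‖v‖ - ‖u‖| := by
      rw [← abs_of_pos hv', ← abs_mul, abs_of_pos hv', ← abs_of_pos (inv_pos.2 hu'), ← abs_mul,
        abs_of_pos (inv_pos.2 hu')]
      congr 1
      field_simp
    rw [this]
    calc ‖u‖⁻¹ * |‖v‖ - ‖u‖| ≤ 1 * |‖v‖ - ‖u‖| := by gcongr
      _ ≤ ‖u - v‖ := by rw [one_mul, norm_sub_rev]; exact abs_norm_sub_norm_le v u
  rw [h1]
  calc _ ≤ ‖u‖⁻¹ * ‖u - v‖ + |‖u‖⁻¹ - ‖v‖⁻¹| * ‖v‖ := by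
        refine (norm_add_le _ _).trans ?_
        rw [norm_smul, norm_smul, Real.norm_of_nonneg (inv_pos.2 hu').le, Real.norm_eq_abs]
    _ ≤ 1 * ‖u - v‖ + ‖u - v‖ := by gcongr
    _ = _ := by ring

lemma lineProj_apply_unit {n : ℕ} (N v : EuclideanSpace ℝ (Fin n)) :
    lineProj N v = inner ℝ (‖N‖⁻¹ • N) v • (‖N‖⁻¹ • N) := by
  rw [lineProj_apply, inner_smul_left, smul_smul]
  congr 1
  simp
  ring

lemma norm_lineProj_sub_le {n : ℕ} {u v : EuclideanSpace ℝ (Fin n)} (hu : 1 ≤ ‖u‖)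
    (hv : 1 ≤ ‖v‖) : ‖lineProj u - lineProj v‖ ≤ 4 * ‖u - v‖ := by
  refine ContinuousLinearMap.opNorm_le_bound _ (by positivity) fun w => ?_
  have hu' : ‖u‖ ≠ 0 := by linarith
  have hv' : ‖v‖ ≠ 0 := by linarith
  have key := norm_inv_norm_smul_sub_le hu hv
  rw [sub_apply, lineProj_apply_unit, lineProj_apply_unit]
  have hnu : ‖‖u‖⁻¹ • u‖ = 1 := by rw [norm_smul, norm_inv, norm_norm, inv_mul_cancel₀ hu']
  have hnv : ‖‖v‖⁻¹ • v‖ = 1 := by rw [norm_smul, norm_inv, norm_norm, inv_mul_cancel₀ hv']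
  generalize ‖u‖⁻¹ • u = m at *
  generalize ‖v‖⁻¹ • v = k at *
  have h1 : inner ℝ m w • m - inner ℝ k w • k
      = inner ℝ (m - k) w • m + inner ℝ k w • (m - k) := by
    rw [inner_sub_left, sub_smul, smul_sub]; abel
  rw [h1]
  calc _ ≤ ‖m - k‖ * ‖w‖ * ‖m‖ + ‖k‖ * ‖w‖ * ‖m - k‖ := by
        refine (norm_add_le _ _).trans ?_
        rw [norm_smul, norm_smul]
        gcongr <;> exact norm_inner_le_norm _ _
    _ = 2 * ‖m - k‖ * ‖w‖ := by rw [hnu, hnv]; ring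
    _ ≤ 2 * (2 * ‖u - v‖) * ‖w‖ := by gcongr
    _ = _ := by ring

/-- If the normals `u`, `v` have length at least `1`, their components along a unit vector `w`,
normalised as in `lineProj`, differ by at most what `u` and `v` do in that component, plus a term
that is small when the component itself is. -/
lemma norm_lineProj_sub_apply_le {n : ℕ} {u v w : EuclideanSpace ℝ (Fin n)} (hu : 1 ≤ ‖u‖)
    (hv : 1 ≤ ‖v‖) :
    ‖lineProj u w - lineProj v w‖ ≤
      |inner ℝ u w - inner ℝ v w| + 3 * |inner ℝ v w| * ‖u - v‖ := by
  have hu' : 0 < ‖u‖ := by linarith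
  have hv' : 0 < ‖v‖ := by linarith
  have key := norm_inv_norm_smul_sub_le hu hv
  have hinv : |‖u‖⁻¹ - ‖v‖⁻¹| ≤ ‖u - v‖ := by
    have h : ‖u‖⁻¹ - ‖v‖⁻¹ = (‖u‖ * ‖v‖)⁻¹ * (‖v‖ - ‖u‖) := by field_simp
    rw [h, abs_mul, abs_of_pos (by positivity)]
    calc _ ≤ 1 * |‖v‖ - ‖u‖| := by
          gcongr
          exact inv_le_one_of_one_le₀ (by nlinarith)
      _ ≤ ‖u - v‖ := by rw [one_mul, norm_sub_rev]; exact abs_norm_sub_norm_le v u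
  rw [lineProj_apply_unit, lineProj_apply_unit]
  have hnu : ‖‖u‖⁻¹ • u‖ = 1 := by
    rw [norm_smul, norm_inv, norm_norm, inv_mul_cancel₀ hu'.ne']
  have h1 : inner ℝ (‖u‖⁻¹ • u) w • (‖u‖⁻¹ • u) - inner ℝ (‖v‖⁻¹ • v) w • (‖v‖⁻¹ • v)
      = (‖u‖⁻¹ * (inner ℝ u w - inner ℝ v w) + (‖u‖⁻¹ - ‖v‖⁻¹) * inner ℝ v w) • (‖u‖⁻¹ • u)
        + (‖v‖⁻¹ * inner ℝ v w) • (‖u‖⁻¹ • u - ‖v‖⁻¹ • v) := by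
    rw [real_inner_smul_left, real_inner_smul_left, smul_sub]
    rw [show ‖u‖⁻¹ * (inner ℝ u w - inner ℝ v w) + (‖u‖⁻¹ - ‖v‖⁻¹) * inner ℝ v w
      = ‖u‖⁻¹ * inner ℝ u w - ‖v‖⁻¹ * inner ℝ v w by ring, sub_smul]
    abel
  rw [h1]
  have hiu : ‖u‖⁻¹ ≤ 1 := inv_le_one_of_one_le₀ hu
  have hiv : ‖v‖⁻¹ ≤ 1 := inv_le_one_of_one_le₀ hv
  calc _ ≤ (‖u‖⁻¹ * |inner ℝ u w - inner ℝ v w| + |‖u‖⁻¹ - ‖v‖⁻¹| * |inner ℝ v w|) * 1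
          + (‖v‖⁻¹ * |inner ℝ v w|) * ‖‖u‖⁻¹ • u - ‖v‖⁻¹ • v‖ := by
        refine (norm_add_le _ _).trans ?_
        rw [norm_smul _ (‖u‖⁻¹ • u), hnu, norm_smul (‖v‖⁻¹ * _)]
        gcongr
        · rw [Real.norm_eq_abs]
          refine (abs_add_le _ _).trans ?_
          rw [abs_mul, abs_mul, abs_of_pos (inv_pos.2 hu')]
        · rw [Real.norm_eq_abs, abs_mul, abs_of_pos (inv_pos.2 hv')]
    _ ≤ (1 * |inner ℝ u w - inner ℝ v w| + ‖u - v‖ * |inner ℝ v w|) * 1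
          + (1 * |inner ℝ v w|) * (2 * ‖u - v‖) := by gcongr
    _ = _ := by ring

lemma tangentProj_eq_one_sub_lineProj {n : ℕ} {M : Set (EuclideanSpace ℝ (Fin n))}
    {q N : EuclideanSpace ℝ (Fin n)} (h : tangentSpaceAt M q = (Submodule.span ℝ {N})ᗮ) :
    tangentProj M q = 1 - lineProj N := by
  simp only [tangentProj, h, lineProj, Submodule.starProjection_orthogonal']

/-! ### The surface and its two strata -/

/-- The polynomial whose zero set is `surfaceV a b c d`. -/
def surfacePoly (a b c d : ℕ) (v : EuclideanSpace ℝ (Fin 3)) : ℝ :=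
  v 1 ^ a - (v 2 ^ b * v 0 ^ c + v 0 ^ d)

/-- The gradient of `surfacePoly a b c d`. -/
noncomputable def surfaceGrad (a b c d : ℕ) (v : EuclideanSpace ℝ (Fin 3)) :
    EuclideanSpace ℝ (Fin 3) :=
  !₂[-(c * v 2 ^ b * v 0 ^ (c - 1) + d * v 0 ^ (d - 1)), a * v 1 ^ (a - 1),
    -(b * v 2 ^ (b - 1) * v 0 ^ c)]

/-- The unit vector spanning the `z`-axis. -/
noncomputable def axisVec : EuclideanSpace ℝ (Fin 3) := EuclideanSpace.single 2 1

/-- The distance to the `z`-axis. -/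
noncomputable def axisDist (v : EuclideanSpace ℝ (Fin 3)) : ℝ := √(v 0 ^ 2 + v 1 ^ 2)

/-- The point of the `z`-axis nearest to `v`. -/
noncomputable def axisFoot (v : EuclideanSpace ℝ (Fin 3)) : EuclideanSpace ℝ (Fin 3) :=
  !₂[0, 0, v 2]

lemma surfaceV_eq (a b c d : ℕ) : surfaceV a b c d = {v | surfacePoly a b c d v = 0} := by
  ext v
  simp [surfaceV, surfacePoly, sub_eq_zero]

lemma hasStrictFDerivAt_surfacePoly (a b c d : ℕ) (q : EuclideanSpace ℝ (Fin 3)) :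
    HasStrictFDerivAt (surfacePoly a b c d) (innerSL ℝ (surfaceGrad a b c d q)) q := by
  have h : ∀ i : Fin 3, HasStrictFDerivAt (fun v : EuclideanSpace ℝ (Fin 3) => v i)
      (EuclideanSpace.proj i : EuclideanSpace ℝ (Fin 3) →L[ℝ] ℝ) q := fun i =>
    (EuclideanSpace.proj i : EuclideanSpace ℝ (Fin 3) →L[ℝ] ℝ).hasStrictFDerivAt
  refine (((h 1).pow a).sub ((((h 2).pow b).mul ((h 0).pow c)).add
    ((h 0).pow d))).congr_fderiv ?_
  ext v
  simp [surfaceGrad, PiLp.inner_apply, Fin.sum_univ_three]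
  ring

lemma contDiff_surfacePoly (a b c d : ℕ) : ContDiff ℝ ∞ (surfacePoly a b c d) := by
  have h : ∀ i : Fin 3, ContDiff ℝ ∞ (fun v : EuclideanSpace ℝ (Fin 3) => v i) := fun i =>
    (EuclideanSpace.proj i : EuclideanSpace ℝ (Fin 3) →L[ℝ] ℝ).contDiff
  exact ((h 1).pow a).sub ((((h 2).pow b).mul ((h 0).pow c)).add ((h 0).pow d))

lemma isClosed_axisOz : IsClosed axisOz := by
  have h : ∀ i : Fin 3, Continuous (fun v : EuclideanSpace ℝ (Fin 3) => v i) := fun i =>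
    (EuclideanSpace.proj i : EuclideanSpace ℝ (Fin 3) →L[ℝ] ℝ).continuous
  exact (isClosed_eq (h 0) continuous_const).inter (isClosed_eq (h 1) continuous_const)

lemma openStratum_two (a b c d : ℕ) (U : Set (EuclideanSpace ℝ (Fin 3))) :
    openStratum (surfaceFiltration a b c d U) 1 2 = (surfaceV a b c d \ axisOz) ∩ U := by
  ext v
  simp [openStratum, surfaceFiltration]
  tauto

lemma openStratum_one (a b c d : ℕ) (U : Set (EuclideanSpace ℝ (Fin 3))) :
    openStratum (surfaceFiltration a b c d U) 1 1 = axisOz ∩ U := by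
  simp [openStratum, surfaceFiltration]

lemma tangentProj_openStratum_two {a b c d : ℕ} {U : Set (EuclideanSpace ℝ (Fin 3))}
    (hU : IsOpen U) {q : EuclideanSpace ℝ (Fin 3)} (hq : q ∈ (surfaceV a b c d \ axisOz) ∩ U)
    (hN : surfaceGrad a b c d q ≠ 0) :
    tangentProj (openStratum (surfaceFiltration a b c d U) 1 2) q
      = 1 - lineProj (surfaceGrad a b c d q) := by
  apply tangentProj_eq_one_sub_lineProj
  rw [openStratum_two]
  refine tangentSpaceAt_eq_orthogonal_gradient (hasStrictFDerivAt_surfacePoly a b c d q) hN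
    (W := U \ axisOz) ((hU.sdiff isClosed_axisOz).mem_nhds ⟨hq.2, hq.1.2⟩) ?_ hq
  rw [surfaceV_eq]
  ext v
  simp
  tauto

lemma inner_axisVec (v : EuclideanSpace ℝ (Fin 3)) : inner ℝ v axisVec = v 2 := by
  simp [axisVec, EuclideanSpace.inner_single_right]

lemma lineProj_axisVec (v : EuclideanSpace ℝ (Fin 3)) : lineProj axisVec v = v 2 • axisVec := by
  rw [lineProj_apply, real_inner_comm, inner_axisVec]
  simp [axisVec]

lemma tangentProj_openStratum_one {a b c d : ℕ} {U : Set (EuclideanSpace ℝ (Fin 3))}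
    (hU : IsOpen U) {q : EuclideanSpace ℝ (Fin 3)} (hq : q ∈ axisOz ∩ U) :
    tangentProj (openStratum (surfaceFiltration a b c d U) 1 1) q = lineProj axisVec := by
  have h : tangentSpaceAt (axisOz ∩ U) q = Submodule.span ℝ {axisVec} := by
    apply le_antisymm
    · refine Submodule.span_le.2 ?_
      rintro v ⟨u, hu0, huM, hu⟩
      have hzero : ∀ i : Fin 3, (∀ p ∈ axisOz, p i = 0) → v i = 0 := by
        intro i hi
        have h1 : HasDerivAt (fun t => u t i) (v i) 0 :=
          (EuclideanSpace.proj i : EuclideanSpace ℝ (Fin 3) →L[ℝ] ℝ).hasFDerivAt.comp_hasDerivAt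
            0 hu
        refine h1.unique ((hasDerivAt_const (0 : ℝ) (0 : ℝ)).congr_of_eventuallyEq ?_)
        filter_upwards [huM] with t ht using hi _ ht.1
      rw [SetLike.mem_coe, Submodule.mem_span_singleton]
      refine ⟨v 2, ?_⟩
      have h0 := hzero 0 fun p hp => hp.1
      have h1 := hzero 1 fun p hp => hp.2
      ext i
      fin_cases i <;> simp [axisVec, h0, h1]
    · rw [Submodule.span_singleton_le_iff_mem]
      apply Submodule.subset_span
      have hu : HasDerivAt (fun t : ℝ => q + t • axisVec) axisVec 0 := by
        simpa only [one_smul, id] using ((hasDerivAt_id (0 : ℝ)).smul_const axisVec).const_add q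
      refine ⟨fun t => q + t • axisVec, by simp, ?_, hu⟩
      have hU' : ∀ᶠ t in nhds (0 : ℝ), q + t • axisVec ∈ U := by
        apply hu.continuousAt.eventually_mem
        simpa using hU.mem_nhds hq.2
      filter_upwards [hU'] with t ht
      refine ⟨⟨?_, ?_⟩, ht⟩
      · simpa [axisVec] using hq.1.1
      · simpa [axisVec] using hq.1.2
  rw [openStratum_one]
  simp only [tangentProj, h, lineProj]

/-! ### Distances -/

lemma norm_sq_three (v : EuclideanSpace ℝ (Fin 3)) : ‖v‖ ^ 2 = v 0 ^ 2 + v 1 ^ 2 + v 2 ^ 2 := by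
  rw [EuclideanSpace.real_norm_sq_eq, Fin.sum_univ_three]

lemma axisDist_nonneg (v : EuclideanSpace ℝ (Fin 3)) : 0 ≤ axisDist v := Real.sqrt_nonneg _

lemma axisDist_sq (v : EuclideanSpace ℝ (Fin 3)) : axisDist v ^ 2 = v 0 ^ 2 + v 1 ^ 2 :=
  Real.sq_sqrt (by positivity)

lemma axisDist_pos {v : EuclideanSpace ℝ (Fin 3)} (hv : v ∉ axisOz) : 0 < axisDist v := by
  apply Real.sqrt_pos.2
  by_contra h
  have h0 : v 0 ^ 2 = 0 := by nlinarith [sq_nonneg (v 0), sq_nonneg (v 1)]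
  have h1 : v 1 ^ 2 = 0 := by nlinarith [sq_nonneg (v 0), sq_nonneg (v 1)]
  exact hv ⟨by simpa using h0, by simpa using h1⟩

lemma axisDist_le_norm_sub {v p : EuclideanSpace ℝ (Fin 3)} (hp : p ∈ axisOz) :
    axisDist v ≤ ‖v - p‖ := by
  apply Real.sqrt_le_iff.2 ⟨norm_nonneg _, ?_⟩
  rw [norm_sq_three]
  have h0 : p 0 = 0 := hp.1
  have h1 : p 1 = 0 := hp.2
  simp only [PiLp.sub_apply, h0, h1]
  nlinarith [sq_nonneg (v 2 - p 2)]

lemma axisDist_le_norm (v : EuclideanSpace ℝ (Fin 3)) : axisDist v ≤ ‖v‖ := by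
  simpa using axisDist_le_norm_sub (v := v) (p := 0) ⟨rfl, rfl⟩

lemma axisFoot_mem (v : EuclideanSpace ℝ (Fin 3)) : axisFoot v ∈ axisOz := by
  constructor <;> simp [axisFoot]

lemma norm_sub_axisFoot (v : EuclideanSpace ℝ (Fin 3)) : ‖v - axisFoot v‖ = axisDist v := by
  rw [← sq_eq_sq₀ (norm_nonneg _) (axisDist_nonneg _), norm_sq_three, axisDist_sq]
  simp [axisFoot]

lemma norm_axisFoot_le (v : EuclideanSpace ℝ (Fin 3)) : ‖axisFoot v‖ ≤ ‖v‖ := by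
  rw [← sq_le_sq₀ (norm_nonneg _) (norm_nonneg _), norm_sq_three, norm_sq_three]
  simp [axisFoot]
  positivity

lemma infDist_axis {U : Set (EuclideanSpace ℝ (Fin 3))} {v : EuclideanSpace ℝ (Fin 3)}
    (hv : axisFoot v ∈ U) : Metric.infDist v (axisOz ∩ U) = axisDist v := by
  apply le_antisymm
  · rw [← norm_sub_axisFoot, ← dist_eq_norm]
    exact Metric.infDist_le_dist_of_mem ⟨axisFoot_mem v, hv⟩
  · have hne : (axisOz ∩ U).Nonempty := ⟨_, axisFoot_mem v, hv⟩
    refine (Metric.le_infDist hne).2 fun p hp => ?_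
    rw [dist_eq_norm]
    exact axisDist_le_norm_sub hp.1

lemma norm_le_abs_add_abs_add_abs (v : EuclideanSpace ℝ (Fin 3)) :
    ‖v‖ ≤ |v 0| + |v 1| + |v 2| := by
  rw [← sq_le_sq₀ (norm_nonneg _) (by positivity)]
  rw [norm_sq_three]
  nlinarith [abs_nonneg (v 0), abs_nonneg (v 1), abs_nonneg (v 2), sq_abs (v 0), sq_abs (v 1),
    sq_abs (v 2), mul_nonneg (abs_nonneg (v 0)) (abs_nonneg (v 1)),
    mul_nonneg (abs_nonneg (v 0)) (abs_nonneg (v 2)),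
    mul_nonneg (abs_nonneg (v 1)) (abs_nonneg (v 2))]

lemma abs_apply_le_norm (v : EuclideanSpace ℝ (Fin 3)) (i : Fin 3) : |v i| ≤ ‖v‖ :=
  PiLp.norm_apply_le v i

lemma axisDist_le_abs_add_abs (v : EuclideanSpace ℝ (Fin 3)) : axisDist v ≤ |v 0| + |v 1| := by
  apply Real.sqrt_le_iff.2 ⟨by positivity, ?_⟩
  nlinarith [sq_abs (v 0), sq_abs (v 1), mul_nonneg (abs_nonneg (v 0)) (abs_nonneg (v 1))]

lemma abs_zero_le_axisDist (v : EuclideanSpace ℝ (Fin 3)) : |v 0| ≤ axisDist v := by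
  apply Real.le_sqrt_of_sq_le
  nlinarith [sq_abs (v 0), sq_nonneg (v 1)]

lemma abs_one_le_axisDist (v : EuclideanSpace ℝ (Fin 3)) : |v 1| ≤ axisDist v := by
  apply Real.le_sqrt_of_sq_le
  nlinarith [sq_abs (v 1), sq_nonneg (v 0)]

/-! ### Mostowski's conditions along chains -/

lemma chainProj_two {a b c d : ℕ} {U : Set (EuclideanSpace ℝ (Fin 3))} (hU : IsOpen U)
    {j : ℕ → ℕ} {p : ℕ → EuclideanSpace ℝ (Fin 3)} (hj : j 2 = 1) (hp : p 2 ∈ axisOz ∩ U) :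
    chainProj 1 (surfaceFiltration a b c d U) j p 2 = lineProj axisVec := by
  simp [chainProj, hj, tangentProj_openStratum_one hU hp]

lemma skelDistPred_one {n : ℕ} (S : ℕ → Set (EuclideanSpace ℝ (Fin n)))
    (q : EuclideanSpace ℝ (Fin n)) : skelDistPred S 1 1 q = 1 := by simp [skelDistPred]

lemma skelDistPred_two {a b c d : ℕ} {U : Set (EuclideanSpace ℝ (Fin 3))}
    {q : EuclideanSpace ℝ (Fin 3)} (hq : axisFoot q ∈ U) :
    skelDistPred (surfaceFiltration a b c d U) 1 2 q = axisDist q := by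
  simp [skelDistPred, skelDist, surfaceFiltration, infDist_axis hq]

/-- Conditions (L1) and (L2), read off at the vector spanning the `z`-axis. -/
theorem MostowskiRegular.exists_bounds {γ : ℝ} (hγ : 1 < γ) {a b c d : ℕ}
    (h : MostowskiRegular γ a b c d) :
    ∃ C > 0, ∃ ε > 0, ∀ q ∈ surfaceV a b c d \ axisOz, ‖q‖ < ε → surfaceGrad a b c d q ≠ 0 →
      ‖lineProj (surfaceGrad a b c d q) axisVec‖ ≤ C * axisDist q ∧
      ∀ q' ∈ surfaceV a b c d \ axisOz, ‖q'‖ < ε → surfaceGrad a b c d q' ≠ 0 →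
        ‖q - q'‖ ≤ 1 / (2 * γ) * axisDist q →
        ‖lineProj (surfaceGrad a b c d q) axisVec - lineProj (surfaceGrad a b c d q') axisVec‖
          ≤ C * ‖q - q'‖ := by
  obtain ⟨U, hU, h0, -, C, hC, H⟩ := h
  obtain ⟨δ, hδ, hball⟩ := Metric.isOpen_iff.1 hU 0 h0
  refine ⟨C, hC, min δ (1 / (2 * γ ^ 2)), by positivity, ?_⟩
  intro q hq hqε hN
  have hqU : ∀ v : EuclideanSpace ℝ (Fin 3), ‖v‖ < min δ (1 / (2 * γ ^ 2)) → v ∈ U := by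
    intro v hv
    apply hball
    rw [mem_ball_zero_iff]
    exact hv.trans_le (min_le_left _ _)
  have hfoot : axisFoot q ∈ axisOz ∩ U :=
    ⟨axisFoot_mem q, hqU _ ((norm_axisFoot_le q).trans_lt hqε)⟩
  let j : ℕ → ℕ := fun s => if s = 1 then 2 else 1
  let p : ℕ → EuclideanSpace ℝ (Fin 3) := fun s => if s = 1 then q else axisFoot q
  have hchain : IsMostowskiChain γ 1 2 (surfaceFiltration a b c d U) q 2 j p := by
    have hs : ∀ s, 1 ≤ s → s < 2 → s = 1 := by omega
    refine ⟨by norm_num, by simp [j], by simp [j], ?_, ?_, ?_, by simp [p], ?_, ?_⟩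
    · intro s h1 h2
      obtain rfl := hs s h1 h2
      simp [j]
    · intro s h1 h2
      obtain rfl := hs s h1 h2
      have : skelDist (surfaceFiltration a b c d U) 1 q = axisDist q := by
        simp [skelDist, surfaceFiltration, infDist_axis hfoot.2]
      simp only [j, Nat.reduceAdd, OfNat.ofNat_ne_one, if_false, this, skelDistPred_one]
      have h3 := (axisDist_le_norm q).trans (hqε.le.trans (min_le_right _ _))
      calc 2 * γ ^ 2 * axisDist q ≤ 2 * γ ^ 2 * (1 / (2 * γ ^ 2)) := by gcongr
        _ = 1 := by field_simp
    · intro s h1 h2 i h3 h4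
      obtain rfl := hs s h1 h2
      simp only [j, Nat.reduceAdd, OfNat.ofNat_ne_one, if_false, if_true] at h3 h4
      omega
    · intro s h1 h2
      obtain rfl | rfl : s = 1 ∨ s = 2 := by omega
      · simp only [j, p, if_true, openStratum_two]
        exact ⟨hq, hqU q hqε⟩
      · simp only [j, p, OfNat.ofNat_ne_one, if_false, openStratum_one]
        exact hfoot
    · intro s h1 h2
      obtain rfl | rfl : s = 1 ∨ s = 2 := by omega
      · simp only [p, if_true, sub_self, norm_zero]
        exact mul_nonneg (by linarith) Metric.infDist_nonneg
      · simp only [j, p, OfNat.ofNat_ne_one, if_false, skelDist, surfaceFiltration, le_refl,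
          if_true, infDist_axis hfoot.2, norm_sub_axisFoot]
        nlinarith [axisDist_nonneg q]
  have hj : j 1 = 2 := by simp [j]
  have hj2 : j 2 = 1 := by simp [j]
  have hp2 : p 2 = axisFoot q := by simp [p]
  obtain ⟨H1, H2⟩ := H q 2 j p hchain
  have hTq := tangentProj_openStratum_two hU ⟨hq, hqU q hqε⟩ hN
  have hcp := chainProj_two (a := a) (b := b) (c := c) (d := d) hU hj2 (p := p)
    (by rw [hp2]; exact hfoot)
  have hunit : ‖axisVec‖ = 1 := by simp [axisVec]
  have haxis : lineProj axisVec axisVec = axisVec := by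
    rw [lineProj_axisVec]
    simp [axisVec]
  rw [hj] at H1 H2
  constructor
  · have h1 := H1 2 le_rfl le_rfl
    rw [hcp, normalProj, hTq, hj2, skelDistPred_one, hp2, norm_sub_axisFoot, div_one] at h1
    have h2 := ContinuousLinearMap.le_of_opNorm_le _ h1 axisVec
    simpa [haxis, hunit] using h2
  · intro q' hq' hq'ε hN' hqq'
    have h1 := (H2 q' (by rw [openStratum_two]; exact ⟨hq', hqU q' hq'ε⟩)
      (by rw [skelDistPred_two hfoot.2]; exact hqq')).1 2 le_rfl le_rfl
    rw [hcp, hTq, tangentProj_openStratum_two hU ⟨hq', hqU q' hq'ε⟩ hN', hj2, skelDistPred_one,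
      div_one] at h1
    have h2 := ContinuousLinearMap.le_of_opNorm_le _ h1 axisVec
    rw [norm_sub_rev]
    simpa [haxis, hunit] using h2

lemma norm_mul_lineProj_axisVec_le
    (A : EuclideanSpace ℝ (Fin 3) →L[ℝ] EuclideanSpace ℝ (Fin 3)) :
    ‖A * lineProj axisVec‖ ≤ ‖A axisVec‖ := by
  refine ContinuousLinearMap.opNorm_le_bound _ (norm_nonneg _) fun v => ?_
  rw [mul_apply_eq_comp, lineProj_axisVec, map_smul, norm_smul, mul_comm]
  exact mul_le_mul_of_nonneg_left (abs_apply_le_norm v 2) (norm_nonneg _)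

lemma isSubanalyticIn_zeroSet_inter_ball {n : ℕ} {G : EuclideanSpace ℝ (Fin n) → ℝ}
    (hG : AnalyticOnNhd ℝ G Set.univ) {ε : ℝ} (hε : 0 < ε) :
    IsSubanalyticIn (Metric.ball 0 ε) ({v | G v = 0} ∩ Metric.ball 0 ε) := by
  refine ⟨Set.inter_subset_right, fun p hp => ⟨Metric.ball 0 ε, Metric.isOpen_ball, hp, 0,
    {x | G x.1 = 0 ∧ x.1 ∈ Metric.ball (0 : EuclideanSpace ℝ (Fin n)) ε}, ?_, ?_, ?_⟩⟩
  · intro x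
    refine ⟨Set.univ, isOpen_univ, trivial, 1, 1, fun _ _ x => G x.1,
      fun _ _ x => ε ^ 2 - ∑ i, x.1 i ^ 2, ?_, ?_⟩
    · intro _ _
      refine ⟨fun x _ => (hG x.1 trivial).comp analyticAt_fst, fun x _ => ?_⟩
      have h : ∀ i, AnalyticAt ℝ
          (fun x : EuclideanSpace ℝ (Fin n) × EuclideanSpace ℝ (Fin 0) => x.1 i) x := fun i =>
        ((EuclideanSpace.proj i : EuclideanSpace ℝ (Fin n) →L[ℝ] ℝ).comp
          (ContinuousLinearMap.fst ℝ _ _)).analyticAt x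
      exact analyticAt_const.sub (Finset.analyticAt_fun_sum _ fun i _ => (h i).pow 2)
    · ext x
      simp only [Set.mem_inter_iff, Set.mem_ofPred_eq, Set.mem_univ, and_true, true_and,
        exists_const, forall_const, mem_ball_zero_iff, ← EuclideanSpace.real_norm_sq_eq, sub_pos,
        sq_lt_sq₀ (norm_nonneg _) hε.le]
  · refine (Metric.isBounded_ball 
      (x := (0 : EuclideanSpace ℝ (Fin n) × EuclideanSpace ℝ (Fin 0))) (r := ε)).subset ?_
    rintro ⟨v, w⟩ ⟨-, hv⟩
    rw [mem_ball_zero_iff] at hv ⊢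
    rw [Prod.norm_def, Subsingleton.elim w 0, norm_zero]
    exact max_lt hv hε
  · ext v
    constructor
    · rintro ⟨hv, -⟩
      exact ⟨(v, 0), hv, rfl⟩
    · rintro ⟨x, hx, rfl⟩
      exact ⟨hx, hx.2⟩

lemma isStratification_ball {a b c d : ℕ} (ha : 0 < a) (hc : 0 < c) (hd : 0 < d) {ε : ℝ}
    (hε : 0 < ε)
    (hN : ∀ q ∈ surfaceV a b c d \ axisOz, ‖q‖ < ε → surfaceGrad a b c d q ≠ 0) :
    IsStratification (Metric.ball 0 ε) (surfaceV a b c d ∩ Metric.ball 0 ε) 1 2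
      (surfaceFiltration a b c d (Metric.ball 0 ε)) := by
  have hproj : ∀ (i : Fin 3) (x : EuclideanSpace ℝ (Fin 3)),
      AnalyticAt ℝ (fun v : EuclideanSpace ℝ (Fin 3) => v i) x := fun i x =>
    (EuclideanSpace.proj i : EuclideanSpace ℝ (Fin 3) →L[ℝ] ℝ).analyticAt x
  have haxis : axisOz = {v | v 0 ^ 2 + v 1 ^ 2 = 0} := by
    ext v
    constructor
    · rintro ⟨h0, h1⟩
      simp [h0, h1]
    · intro h
      rw [Set.mem_ofPred_eq] at h
      exact ⟨by nlinarith [sq_nonneg (v 0), sq_nonneg (v 1)],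
        by nlinarith [sq_nonneg (v 0), sq_nonneg (v 1)]⟩
  have hsub : axisOz ⊆ surfaceV a b c d := by
    rintro v ⟨h0, h1⟩
    simp [surfaceV, h0, h1, ha.ne', hc.ne', hd.ne']
  have hone : surfaceFiltration a b c d (Metric.ball 0 ε) 1 = axisOz ∩ Metric.ball 0 ε := by
    simp [surfaceFiltration]
  have htwo : surfaceFiltration a b c d (Metric.ball 0 ε) 2
      = surfaceV a b c d ∩ Metric.ball 0 ε := by
    simp [surfaceFiltration]
  have hj : ∀ j, 1 ≤ j → j ≤ 2 → j = 1 ∨ j = 2 := by omega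
  refine ⟨Metric.isOpen_ball, by norm_num, htwo, ?_, ?_, ?_, ?_, ?_⟩
  · rw [hone]
    exact ⟨0, ⟨rfl, rfl⟩, Metric.mem_ball_self hε⟩
  · intro j h1 h2
    obtain rfl : j = 1 := by omega
    rw [hone, htwo]
    exact Set.inter_subset_inter_left _ hsub
  · intro j h1 h2
    obtain rfl | rfl := hj j h1 h2
    · rw [hone, haxis]
      exact isSubanalyticIn_zeroSet_inter_ball
        (fun x _ => ((hproj 0 x).pow 2).add ((hproj 1 x).pow 2)) hε
    · rw [htwo, surfaceV_eq]
      exact isSubanalyticIn_zeroSet_inter_ball (fun x _ => ((hproj 1 x).pow a).sub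
        ((((hproj 2 x).pow b).mul ((hproj 0 x).pow c)).add ((hproj 0 x).pow d))) hε
  · intro j h1 h2
    obtain rfl | rfl := hj j h1 h2
    · exact ⟨_, isClosed_axisOz, hone⟩
    · refine ⟨_, ?_, htwo⟩
      rw [surfaceV_eq]
      exact isClosed_eq (contDiff_surfacePoly a b c d).continuous continuous_const
  · intro j h1 h2
    obtain rfl | rfl := hj j h1 h2
    · rw [openStratum_one]
      intro q hq
      let L : EuclideanSpace ℝ (Fin 3) →L[ℝ] EuclideanSpace ℝ (Fin 2) :=
        (EuclideanSpace.proj 0).smulRight (EuclideanSpace.single 0 1)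
          + (EuclideanSpace.proj 1).smulRight (EuclideanSpace.single 1 1)
      have hL0 : ∀ v, L v 0 = v 0 := fun v => by simp [L]
      have hL1 : ∀ v, L v 1 = v 1 := fun v => by simp [L]
      refine ⟨Metric.ball 0 ε, Metric.isOpen_ball, hq.2, 2, L, rfl, L.contDiff.contDiffOn, ?_, ?_⟩
      · rw [L.fderiv]
        intro w
        refine ⟨!₂[w 0, w 1, 0], ?_⟩
        ext i
        fin_cases i
        · simp [hL0]
        · simp [hL1]
      · ext v
        rw [Set.inter_assoc, Set.inter_self]
        constructor
        · rintro ⟨⟨h0, h1⟩, hv⟩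
          refine ⟨hv, ?_⟩
          ext i
          fin_cases i
          · simpa [hL0] using h0
          · simpa [hL1] using h1
        · rintro ⟨hv, h⟩
          exact ⟨⟨by rw [← hL0, h]; rfl, by rw [← hL1, h]; rfl⟩, hv⟩
    · rw [openStratum_two]
      intro q hq
      let e : EuclideanSpace ℝ (Fin 1) := EuclideanSpace.single 0 1
      have hder : HasFDerivAt (fun v => surfacePoly a b c d v • e)
          ((innerSL ℝ (surfaceGrad a b c d q)).smulRight e) q :=
        (hasStrictFDerivAt_surfacePoly a b c d q).hasFDerivAt.smul_const e
      refine ⟨Metric.ball 0 ε \ axisOz, Metric.isOpen_ball.sdiff isClosed_axisOz, ⟨hq.2, hq.1.2⟩,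
        1, fun v => surfacePoly a b c d v • e, rfl,
        ((contDiff_surfacePoly a b c d).smul contDiff_const).contDiffOn, ?_, ?_⟩
      · rw [hder.fderiv]
        intro w
        have hN' : ‖surfaceGrad a b c d q‖ ≠ 0 :=
          norm_ne_zero_iff.2 (hN q hq.1 (by simpa using hq.2))
        refine ⟨(w 0 / ‖surfaceGrad a b c d q‖ ^ 2) • surfaceGrad a b c d q, ?_⟩
        ext i
        fin_cases i
        simp [e, hN']
      · rw [surfaceV_eq]
        have he : e ≠ 0 := by simp [e]
        ext v
        simp only [Set.mem_inter_iff, Set.mem_sdiff, Set.mem_ofPred_eq, smul_eq_zero, he, or_false]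
        tauto

/-- A sufficient condition for regularity: the surface has a normal field `ν` of length at least
`1` whose Lipschitz constant at distance `ρ` from the axis is `O(1/ρ)`, and whose last component is
`O(ρ)` and Lipschitz. -/
theorem mostowskiRegular_of_normalField {γ : ℝ} (hγ : 1 < γ) {a b c d : ℕ} (ha : 0 < a)
    (hc : 0 < c) (hd : 0 < d) {ε K : ℝ} (hε : 0 < ε) (hK : 0 ≤ K)
    (ν : EuclideanSpace ℝ (Fin 3) → EuclideanSpace ℝ (Fin 3))
    (hν : ∀ q ∈ surfaceV a b c d \ axisOz, ‖q‖ < ε →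
      (∃ r : ℝ, r ≠ 0 ∧ surfaceGrad a b c d q = r • ν q) ∧ 1 ≤ ‖ν q‖ ∧
        |ν q 2| ≤ K * axisDist q ∧
      ∀ q' ∈ surfaceV a b c d \ axisOz, ‖q'‖ < ε → ‖q - q'‖ ≤ axisDist q / 2 →
        axisDist q * ‖ν q - ν q'‖ ≤ K * ‖q - q'‖ ∧ |ν q 2 - ν q' 2| ≤ K * ‖q - q'‖) :
    MostowskiRegular γ a b c d := by
  have hN : ∀ q ∈ surfaceV a b c d \ axisOz, ‖q‖ < ε → surfaceGrad a b c d q ≠ 0 := by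
    intro q hq hqε
    obtain ⟨⟨r, hr, h1⟩, h2, -⟩ := hν q hq hqε
    rw [h1]
    exact smul_ne_zero hr (norm_ne_zero_iff.1 (by linarith))
  have hline : ∀ q ∈ surfaceV a b c d \ axisOz, ‖q‖ < ε →
      lineProj (surfaceGrad a b c d q) = lineProj (ν q) := by
    intro q hq hqε
    obtain ⟨⟨r, hr, h1⟩, -⟩ := hν q hq hqε
    rw [h1, lineProj_smul hr]
  refine ⟨Metric.ball 0 ε, Metric.isOpen_ball, Metric.mem_ball_self hε,
    isStratification_ball ha hc hd hε hN, 5 * K + 3 * K ^ 2 + 1, by positivity, ?_⟩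
  have hU : IsOpen (Metric.ball (0 : EuclideanSpace ℝ (Fin 3)) ε) := Metric.isOpen_ball
  intro q r j p hch
  have hr : r = 1 ∧ j 1 = 1 ∨ r = 2 ∧ j 1 = 2 ∧ j 2 = 1 := by
    have h1 := hch.one_le
    have h2 := hch.top_le
    have h3 := hch.last
    rcases Nat.lt_or_ge 1 r with h | h
    · right
      have h4 := hch.decreasing 1 le_rfl h
      rcases Nat.lt_or_ge 2 r with h' | h'
      · have h5 := hch.decreasing 2 (by norm_num) h'
        norm_num at h4 h5
        omega
      · norm_num at h4
        omega
    · left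
      obtain rfl : r = 1 := by omega
      exact ⟨rfl, h3⟩
  rcases hr with ⟨rfl, hj⟩ | ⟨rfl, hj1, hj2⟩
  · refine ⟨fun k h1 h2 => by omega, fun q' hq' hqq' => ⟨fun k h1 h2 => by omega, ?_⟩⟩
    have hq := hch.mem 1 le_rfl le_rfl
    rw [hch.first] at hq
    rw [hj] at hq hq' ⊢
    rw [openStratum_one] at hq hq'
    rw [tangentProj_openStratum_one hU hq, tangentProj_openStratum_one hU hq', sub_self,
      norm_zero, skelDistPred_one]
    positivity
  · have hq := hch.mem 1 le_rfl one_le_two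
    rw [hch.first, hj1, openStratum_two] at hq
    have hp2 := hch.mem 2 one_le_two le_rfl
    rw [hj2, openStratum_one] at hp2
    have hqε : ‖q‖ < ε := by simpa using hq.2
    have hfoot : axisFoot q ∈ Metric.ball (0 : EuclideanSpace ℝ (Fin 3)) ε := by
      rw [mem_ball_zero_iff]
      exact (norm_axisFoot_le q).trans_lt hqε
    have hTq := tangentProj_openStratum_two hU hq (hN q hq.1 hqε)
    rw [hline q hq.1 hqε] at hTq
    have hρ := axisDist_pos hq.1.2
    obtain ⟨-, hlen, hz, hpair⟩ := hν q hq.1 hqε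
    rw [hj1, skelDistPred_two hfoot]
    refine ⟨?_, ?_⟩
    · intro k h1 h2
      obtain rfl : k = 2 := by omega
      rw [chainProj_two hU hj2 hp2, hj2, skelDistPred_one, div_one, normalProj, hTq, sub_sub_cancel]
      refine (norm_mul_lineProj_axisVec_le _).trans ?_
      have hproj : ‖lineProj (ν q) axisVec‖ ≤ |ν q 2| := by
        have hpos : 0 < ‖ν q‖ := by linarith
        rw [lineProj_apply, inner_axisVec, norm_smul, norm_div, Real.norm_eq_abs, norm_pow,
          norm_norm]
        have : |ν q 2| / ‖ν q‖ ^ 2 * ‖ν q‖ = |ν q 2| / ‖ν q‖ := by field_simp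
        rw [this]
        exact div_le_self (abs_nonneg _) hlen
      calc _ ≤ K * axisDist q := hproj.trans hz
        _ ≤ K * ‖q - p 2‖ := by gcongr; exact axisDist_le_norm_sub hp2.1
        _ ≤ _ := by gcongr; nlinarith
    · intro q' hq' hqq'
      rw [openStratum_two] at hq'
      have hq'ε : ‖q'‖ < ε := by simpa using hq'.2
      have hTq' := tangentProj_openStratum_two hU hq' (hN q' hq'.1 hq'ε)
      rw [hline q' hq'.1 hq'ε] at hTq'
      have hhalf : ‖q - q'‖ ≤ axisDist q / 2 := by
        refine hqq'.trans ?_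
        have : 1 / (2 * γ) ≤ 1 / 2 := by gcongr; linarith
        nlinarith
      obtain ⟨hl, hl2⟩ := hpair q' hq'.1 hq'ε hhalf
      have hlen' := (hν q' hq'.1 hq'ε).2.1
      rw [hTq, hTq', sub_sub_sub_cancel_left]
      refine ⟨?_, ?_⟩
      · intro k h1 h2
        obtain rfl : k = 2 := by omega
        rw [chainProj_two hU hj2 hp2, hj2, skelDistPred_one, div_one]
        refine (norm_mul_lineProj_axisVec_le _).trans ?_
        rw [sub_apply]
        refine (norm_lineProj_sub_apply_le hlen' hlen).trans ?_
        rw [inner_axisVec, inner_axisVec, abs_sub_comm, norm_sub_rev]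
        have h3 : |ν q 2| * ‖ν q - ν q'‖ ≤ K * (K * ‖q - q'‖) :=
          calc _ ≤ K * axisDist q * ‖ν q - ν q'‖ := by gcongr
            _ = K * (axisDist q * ‖ν q - ν q'‖) := by ring
            _ ≤ _ := by gcongr
        nlinarith [norm_nonneg (q - q')]
      · refine (norm_lineProj_sub_le hlen' hlen).trans ?_
        rw [le_div_iff₀ hρ, norm_sub_rev]
        nlinarith [norm_nonneg (q - q'), mul_nonneg hK (norm_nonneg (q - q')),
          mul_nonneg (sq_nonneg K) (norm_nonneg (q - q'))]

/-! ### Failure of regularity -/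

/-- The necessary conditions of `MostowskiRegular.exists_bounds` in coordinates. The gradient is
`(-nx, ny, -nz)`. -/
lemma MostowskiRegular.exists_coord_bounds {γ : ℝ} (hγ : 1 < γ) {a b c d : ℕ}
    (h : MostowskiRegular γ a b c d) :
    ∃ C > 0, ∃ ε > 0, ∀ x y z nx ny nz : ℝ, y ^ a = z ^ b * x ^ c + x ^ d → (x ≠ 0 ∨ y ≠ 0) →
      |x| + |y| + |z| < ε → nx = c * z ^ b * x ^ (c - 1) + d * x ^ (d - 1) →
      ny = a * y ^ (a - 1) → nz = b * z ^ (b - 1) * x ^ c → 0 < nx ^ 2 + ny ^ 2 + nz ^ 2 →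
      |nz| ≤ C * (|x| + |y|) * (|nx| + |ny| + |nz|) ∧
      ∀ x' y' z' nx' ny' nz' : ℝ, y' ^ a = z' ^ b * x' ^ c + x' ^ d → (x' ≠ 0 ∨ y' ≠ 0) →
        |x'| + |y'| + |z'| < ε → nx' = c * z' ^ b * x' ^ (c - 1) + d * x' ^ (d - 1) →
        ny' = a * y' ^ (a - 1) → nz' = b * z' ^ (b - 1) * x' ^ c →
        0 < nx' ^ 2 + ny' ^ 2 + nz' ^ 2 →
        (2 * γ * (|x - x'| + |y - y'| + |z - z'|) ≤ |x| ∨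
          2 * γ * (|x - x'| + |y - y'| + |z - z'|) ≤ |y|) →
        |nz * nx / (nx ^ 2 + ny ^ 2 + nz ^ 2) - nz' * nx' / (nx' ^ 2 + ny' ^ 2 + nz' ^ 2)|
            ≤ C * (|x - x'| + |y - y'| + |z - z'|) ∧
        |nz * ny / (nx ^ 2 + ny ^ 2 + nz ^ 2) - nz' * ny' / (nx' ^ 2 + ny' ^ 2 + nz' ^ 2)|
            ≤ C * (|x - x'| + |y - y'| + |z - z'|) := by
  obtain ⟨C, hC, ε, hε, H⟩ := h.exists_bounds hγ
  refine ⟨C, hC, ε, hε, ?_⟩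
  have hmem : ∀ x y z : ℝ, y ^ a = z ^ b * x ^ c + x ^ d → (x ≠ 0 ∨ y ≠ 0) →
      (!₂[x, y, z] : EuclideanSpace ℝ (Fin 3)) ∈ surfaceV a b c d \ axisOz := by
    intro x y z h1 h2
    refine ⟨by simpa [surfaceV] using h1, ?_⟩
    rintro ⟨h3, h4⟩
    simp at h3 h4
    tauto
  have hnorm : ∀ x y z : ℝ, ‖(!₂[x, y, z] : EuclideanSpace ℝ (Fin 3))‖ ≤ |x| + |y| + |z| :=
    fun x y z => by simpa using norm_le_abs_add_abs_add_abs !₂[x, y, z]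
  have hgrad : ∀ x y z nx ny nz : ℝ, nx = c * z ^ b * x ^ (c - 1) + d * x ^ (d - 1) →
      ny = a * y ^ (a - 1) → nz = b * z ^ (b - 1) * x ^ c →
      surfaceGrad a b c d !₂[x, y, z] = !₂[-nx, ny, -nz] := by
    rintro x y z _ _ _ rfl rfl rfl
    simp [surfaceGrad]
  have hsq : ∀ nx ny nz : ℝ, ‖(!₂[-nx, ny, -nz] : EuclideanSpace ℝ (Fin 3))‖ ^ 2
      = nx ^ 2 + ny ^ 2 + nz ^ 2 := fun nx ny nz => by simp [norm_sq_three]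
  have hne : ∀ nx ny nz : ℝ, 0 < nx ^ 2 + ny ^ 2 + nz ^ 2 →
      (!₂[-nx, ny, -nz] : EuclideanSpace ℝ (Fin 3)) ≠ 0 := by
    intro nx ny nz h0 h1
    rw [← hsq, h1] at h0
    simp at h0
  intro x y z nx ny nz h1 h2 h3 hnx hny hnz hpos
  have hg := hgrad x y z nx ny nz hnx hny hnz
  have H1 := H _ (hmem x y z h1 h2) ((hnorm x y z).trans_lt h3) (by rw [hg]; exact hne _ _ _ hpos)
  rw [hg] at H1
  constructor
  · have H2 := H1.1
    have hN : 0 < ‖(!₂[-nx, ny, -nz] : EuclideanSpace ℝ (Fin 3))‖ :=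
      norm_pos_iff.2 (hne _ _ _ hpos)
    have hlow : |nz| = ‖lineProj !₂[-nx, ny, -nz] axisVec‖
        * ‖(!₂[-nx, ny, -nz] : EuclideanSpace ℝ (Fin 3))‖ := by
      rw [lineProj_apply, inner_axisVec, norm_smul, norm_div, norm_pow, norm_norm]
      have : ‖(!₂[-nx, ny, -nz] : EuclideanSpace ℝ (Fin 3)) 2‖ = |nz| := by simp
      rw [this]
      field_simp
    have h4 : axisDist !₂[x, y, z] ≤ |x| + |y| := by
      simpa using axisDist_le_abs_add_abs !₂[x, y, z]
    have h5 : ‖(!₂[-nx, ny, -nz] : EuclideanSpace ℝ (Fin 3))‖ ≤ |nx| + |ny| + |nz| := by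
      simpa using hnorm (-nx) ny (-nz)
    refine hlow.le.trans ?_
    gcongr
    exact H2.trans (by gcongr)
  · intro x' y' z' nx' ny' nz' h1' h2' h3' hnx' hny' hnz' hpos' hclose
    have hg' := hgrad x' y' z' nx' ny' nz' hnx' hny' hnz'
    have hdist : ‖(!₂[x, y, z] : EuclideanSpace ℝ (Fin 3)) - !₂[x', y', z']‖
        ≤ |x - x'| + |y - y'| + |z - z'| := by
      simpa using norm_le_abs_add_abs_add_abs (!₂[x, y, z] - !₂[x', y', z'])
    have hρ : 2 * γ * (|x - x'| + |y - y'| + |z - z'|) ≤ axisDist !₂[x, y, z] := by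
      rcases hclose with h | h
      · exact h.trans (by simpa using abs_zero_le_axisDist !₂[x, y, z])
      · exact h.trans (by simpa using abs_one_le_axisDist !₂[x, y, z])
    have H2 := H1.2 _ (hmem x' y' z' h1' h2') ((hnorm x' y' z').trans_lt h3')
      (by rw [hg']; exact hne _ _ _ hpos') (by
        rw [one_div, ← div_eq_inv_mul, le_div_iff₀ (by positivity), mul_comm]
        exact (mul_le_mul_of_nonneg_left hdist (by positivity)).trans hρ)
    rw [hg'] at H2
    have H3 := H2.trans (mul_le_mul_of_nonneg_left hdist hC.le)
    have hcomp := fun i => (abs_apply_le_norm _ i).trans H3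
    simp only [lineProj_apply, inner_axisVec, hsq] at hcomp
    have e0 := hcomp 0
    have e1 := hcomp 1
    simp only [PiLp.sub_apply, PiLp.smul_apply, smul_eq_mul, Matrix.cons_val] at e0 e1
    refine ⟨?_, ?_⟩
    · refine (congrArg abs ?_).le.trans e0
      ring
    · rw [← abs_neg]
      refine (congrArg abs ?_).le.trans e1
      ring

lemma false_of_one_le_mul {K δ : ℝ} (hδ : 0 < δ) (h : ∀ s, 0 < s → s < δ → 1 ≤ K * s) : False := by
  have hK : 0 < 2 * (|K| + 1) := by positivity
  have hs : 0 < min (δ / 2) (1 / (2 * (|K| + 1))) := by positivity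
  have h1 := h _ hs ((min_le_left _ _).trans_lt (by linarith))
  have h2 := min_le_right (δ / 2) (1 / (2 * (|K| + 1)))
  rw [le_div_iff₀ hK] at h2
  nlinarith [le_abs_self K]

lemma exists_pow_eq_two {n : ℕ} (hn : 0 < n) : ∃ κ : ℝ, κ ^ n = 2 ∧ 1 ≤ κ ∧ κ ≤ 2 := by
  have h : ((2 : ℝ) ^ ((n : ℝ)⁻¹)) ^ n = 2 := Real.rpow_inv_natCast_pow (by norm_num) hn.ne'
  have h1 : (1 : ℝ) ≤ 2 ^ ((n : ℝ)⁻¹) := Real.one_le_rpow (by norm_num) (by positivity)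
  exact ⟨_, h, h1, (le_self_pow₀ h1 hn.ne').trans h.le⟩

/-- On a zero curve `y = 0`, `z ^ b = -x ^ (d - c)` of the right-hand side the normal vector tends
to the `z`-direction too fast for (L1). -/
theorem not_mostowskiRegular_of_zeroCurve {γ : ℝ} (hγ : 1 < γ) {a b c e : ℕ} (ha : 1 < a)
    (hb : 0 < b) (hc : 0 < c) (he : 0 < e) {σ τ : ℝ} (hσ : |σ| = 1) (hτ : |τ| = 1)
    (h : τ ^ b = -σ ^ e) : ¬ MostowskiRegular γ a b c (c + e) := by
  intro hreg
  obtain ⟨C, hC, ε, hε, H⟩ := hreg.exists_coord_bounds hγ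
  have hb' : (1 : ℝ) ≤ b := by exact_mod_cast hb
  refine false_of_one_le_mul (K := C * (e + b)) (δ := min 1 (ε / 2)) (by positivity)
    fun s h0 h1 => ?_
  have hs1 : s < 1 := h1.trans_le (min_le_left _ _)
  have hsε : s < ε / 2 := h1.trans_le (min_le_right _ _)
  have hpow : ∀ {n : ℕ}, 0 < n → s ^ n ≤ s := fun hn => pow_le_of_le_one h0.le hs1.le hn.ne'
  have hpos : ∀ n, 0 < s ^ n := fun n => pow_pos h0 n
  have hσ0 : σ ≠ 0 := by rintro rfl; simp at hσ
  have hτ0 : τ ≠ 0 := by rintro rfl; simp at hτ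
  obtain ⟨b, rfl⟩ := Nat.exists_eq_succ_of_ne_zero hb.ne'
  obtain ⟨c, rfl⟩ := Nat.exists_eq_succ_of_ne_zero hc.ne'
  obtain ⟨a, rfl⟩ := Nat.exists_eq_succ_of_ne_zero (by omega : a ≠ 0)
  have ha0 : a ≠ 0 := by omega
  simp only [Nat.succ_eq_add_one] at *
  have hnx : ((c + 1 : ℕ) : ℝ) * (τ * s ^ e) ^ (b + 1) * (σ * s ^ (b + 1)) ^ (c + 1 - 1)
      + ((c + 1 + e : ℕ) : ℝ) * (σ * s ^ (b + 1)) ^ (c + 1 + e - 1)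
      = e * σ ^ (c + e) * s ^ ((b + 1) * (c + e)) := by
    rw [show c + 1 - 1 = c by omega, show c + 1 + e - 1 = c + e by omega, mul_pow, h]
    push_cast
    ring
  have hnz : ((b + 1 : ℕ) : ℝ) * (τ * s ^ e) ^ (b + 1 - 1) * (σ * s ^ (b + 1)) ^ (c + 1)
      = (b + 1 : ℕ) * τ ^ b * σ ^ (c + 1) * s ^ (e * b + (b + 1) * (c + 1)) := by
    rw [show b + 1 - 1 = b by omega]
    ring
  have key := (H (σ * s ^ (b + 1)) 0 (τ * s ^ e) _ _ _ ?_ (Or.inl ?_) ?_ hnx.symm rfl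
    hnz.symm ?_).1
  · have habs : ∀ n, |s ^ n| = s ^ n := fun n => abs_of_pos (hpos n)
    rw [show a + 1 - 1 = a by omega, zero_pow ha0] at key
    simp only [abs_mul, abs_pow, hσ, hτ, one_pow, abs_of_pos h0, Nat.abs_cast, abs_zero, mul_zero,
      add_zero, mul_one, one_mul] at key
    set Z := s ^ (e * b + (b + 1) * (c + 1)) with hZ
    have hZ0 : 0 < Z := hpos _
    have e1 : s ^ (b + 1) * s ^ ((b + 1) * (c + e)) ≤ s * Z := by
      rw [hZ, ← pow_add, ← pow_succ']
      exact pow_le_pow_of_le_one h0.le hs1.le (by nlinarith)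
    have e2 : s ^ (b + 1) * Z ≤ s * Z := by gcongr; exact hpow (by omega)
    have e3 : Z ≤ C * (e + (b + 1 : ℕ)) * s * Z :=
      calc Z ≤ (b + 1 : ℕ) * Z := le_mul_of_one_le_left hZ0.le hb'
        _ ≤ _ := key
        _ = C * (e * (s ^ (b + 1) * s ^ ((b + 1) * (c + e))) + (b + 1 : ℕ) * (s ^ (b + 1) * Z)) :=
          by ring
        _ ≤ C * (e * (s * Z) + (b + 1 : ℕ) * (s * Z)) := by gcongr
        _ = _ := by ring
    exact (le_mul_iff_one_le_left hZ0).1 e3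
  · rw [zero_pow (by omega), mul_pow τ, h]
    ring
  · exact mul_ne_zero hσ0 (hpos _).ne'
  · simp only [abs_mul, hσ, hτ, abs_zero, abs_of_pos (hpos _), one_mul]
    linarith [hpow he, hpow hb]
  · have : ((b + 1 : ℕ) : ℝ) * τ ^ b * σ ^ (c + 1) * s ^ (e * b + (b + 1) * (c + 1)) ≠ 0 := by
      have := (hpos (e * b + (b + 1) * (c + 1))).ne'
      have : ((b + 1 : ℕ) : ℝ) ≠ 0 := by positivity
      simp_all
    positivity

/-- The values along the curve `x = s ^ (a * b)`, `z = s ^ (a * e)`, on which the two summands of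
the right-hand side agree: all gradient components are monomials in `s`. -/
lemma curve_gradient {a b c : ℕ} (ha : 0 < a) (hb : 0 < b) (hc : 0 < c) (e : ℕ) {κ : ℝ}
    (hκ : κ ^ a = 2) :
    ∃ nX nY nZ : ℕ, nX + a * b = a * b * (c + e) ∧ nY + (c + e) * b = a * b * (c + e) ∧
      nZ + a * e = a * b * (c + e) ∧ ∀ s : ℝ,
      (κ * s ^ ((c + e) * b)) ^ a
        = (s ^ (a * e)) ^ b * (s ^ (a * b)) ^ c + (s ^ (a * b)) ^ (c + e) ∧
      (2 * c + e) * s ^ nX = c * (s ^ (a * e)) ^ b * (s ^ (a * b)) ^ (c - 1)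
        + (c + e : ℕ) * (s ^ (a * b)) ^ (c + e - 1) ∧
      a * κ ^ (a - 1) * s ^ nY = a * (κ * s ^ ((c + e) * b)) ^ (a - 1) ∧
      b * s ^ nZ = b * (s ^ (a * e)) ^ (b - 1) * (s ^ (a * b)) ^ c := by
  obtain ⟨a, rfl⟩ := Nat.exists_eq_succ_of_ne_zero ha.ne'
  obtain ⟨b, rfl⟩ := Nat.exists_eq_succ_of_ne_zero hb.ne'
  obtain ⟨c, rfl⟩ := Nat.exists_eq_succ_of_ne_zero hc.ne'
  simp only [Nat.succ_eq_add_one, Nat.add_sub_cancel] at *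
  refine ⟨(a + 1) * (b + 1) * (c + e), (c + 1 + e) * (b + 1) * a,
    (a + 1) * e * b + (a + 1) * (b + 1) * (c + 1), by ring, by ring, by ring, fun s => ?_⟩
  rw [show c + 1 + e - 1 = c + e by omega, mul_pow κ, hκ]
  refine ⟨by ring, ?_, by ring, by ring⟩
  push_cast
  ring

/-- The contradiction with (L2) along the curve of `curve_gradient`: `nI` is the dominant gradient
component, of order `nM`, and `m` is the order of the distance. -/
lemma one_le_mul_of_dominant {s nx ny nz nI L P : ℝ} {nM nZ m : ℕ} (h0 : 0 < s) (h1 : s < 1)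
    (hL : 0 ≤ L) (hx : |nx| ≤ P * s ^ nM) (hy : |ny| ≤ P * s ^ nM) (hz : |nz| ≤ P * s ^ nM)
    (hz' : s ^ nZ ≤ |nz|) (hI : s ^ nM ≤ |nI|)
    (h : |nz * nI / (nx ^ 2 + ny ^ 2 + nz ^ 2)| ≤ L * s ^ m) (hm : nZ + 1 ≤ m + nM) :
    1 ≤ 3 * L * P ^ 2 * s := by
  have hM : 0 < s ^ nM := pow_pos h0 _
  have hZ : 0 < s ^ nZ := pow_pos h0 _
  have hnz : 0 < nz ^ 2 := by rw [← sq_abs]; exact pow_pos (hZ.trans_le hz') 2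
  have hS : 0 < nx ^ 2 + ny ^ 2 + nz ^ 2 := by positivity
  rw [abs_div, abs_of_pos hS, div_le_iff₀ hS, abs_mul] at h
  have hsq : ∀ t : ℝ, |t| ≤ P * s ^ nM → t ^ 2 ≤ P ^ 2 * (s ^ nM) ^ 2 := fun t ht => by
    rw [← sq_abs, ← mul_pow]
    exact pow_le_pow_left₀ (abs_nonneg _) ht 2
  have hS' : nx ^ 2 + ny ^ 2 + nz ^ 2 ≤ 3 * P ^ 2 * (s ^ nM) ^ 2 := by
    linarith [hsq _ hx, hsq _ hy, hsq _ hz]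
  have h3 : s ^ m * s ^ nM ≤ s * s ^ nZ := by
    rw [← pow_add, ← pow_succ']
    exact pow_le_pow_of_le_one h0.le h1.le hm
  have h4 : s ^ nZ * s ^ nM ≤ 3 * L * P ^ 2 * s * (s ^ nZ * s ^ nM) :=
    calc s ^ nZ * s ^ nM ≤ |nz| * |nI| := by gcongr
      _ ≤ L * s ^ m * (3 * P ^ 2 * (s ^ nM) ^ 2) := h.trans (by gcongr)
      _ = 3 * L * P ^ 2 * s ^ nM * (s ^ m * s ^ nM) := by ring
      _ ≤ 3 * L * P ^ 2 * s ^ nM * (s * s ^ nZ) := by gcongr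
      _ = _ := by ring
  exact (le_mul_iff_one_le_left (mul_pos hZ hM)).1 h4

/-- (L1) fails along the curve of `curve_gradient` when its orders satisfy
`|(c + e) * b - a * b| < a * e`. -/
theorem not_mostowskiRegular_of_curve {γ : ℝ} (hγ : 1 < γ) {a b c e : ℕ} (ha : 0 < a)
    (hb : 0 < b) (hc : 0 < c) (he : 0 < e) (h1 : (c + e) * b < a * e + a * b)
    (h2 : a * b < a * e + (c + e) * b) : ¬ MostowskiRegular γ a b c (c + e) := by
  intro hreg
  obtain ⟨κ, hκ, hκ1, hκ2⟩ := exists_pow_eq_two ha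
  obtain ⟨nX, nY, nZ, hX, hY, hZ, hcurve⟩ := curve_gradient ha hb hc e hκ
  obtain ⟨C, hC, ε, hε, H⟩ := hreg.exists_coord_bounds hγ
  have hκ' : κ ^ (a - 1) ≤ 2 := (pow_le_pow_right₀ hκ1 (Nat.sub_le a 1)).trans hκ.le
  have hA : 0 < a * b := by positivity
  have hB : 0 < (c + e) * b := by positivity
  have hE : 0 < a * e := by positivity
  have hb' : (1 : ℝ) ≤ b := by exact_mod_cast hb
  generalize a * b = A at *
  generalize (c + e) * b = B at *
  generalize a * e = E at *
  refine false_of_one_le_mul (K := 3 * C * (2 * c + e + a * 2 + b)) (δ := min 1 (ε / 4))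
    (by positivity) fun s h0 hs => ?_
  have hs1 : s < 1 := hs.trans_le (min_le_left _ _)
  have hsε : s < ε / 4 := hs.trans_le (min_le_right _ _)
  have hpos : ∀ n, 0 < s ^ n := fun n => pow_pos h0 n
  have hle : ∀ {n : ℕ}, 0 < n → s ^ n ≤ s := fun hn => pow_le_of_le_one h0.le hs1.le hn.ne'
  obtain ⟨hV, hx, hy, hz⟩ := hcurve s
  have hκ0 : 0 < κ := by linarith
  have key := (H _ _ _ _ _ _ hV (Or.inl (hpos _).ne') (by
    rw [abs_of_pos (hpos _), abs_of_pos (mul_pos hκ0 (hpos _)), abs_of_pos (hpos _)]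
    nlinarith [hle hA, hle hB, hle hE, hpos B]) hx hy hz (by
    have := hpos nZ
    positivity)).1
  have hnx : 0 ≤ (2 * c + e) * s ^ nX := by positivity
  have hny : 0 ≤ a * κ ^ (a - 1) * s ^ nY := by positivity
  have hnz : 0 ≤ b * s ^ nZ := by positivity
  rw [abs_of_nonneg hnx, abs_of_nonneg hny, abs_of_nonneg hnz, abs_of_pos (hpos _),
    abs_of_pos (mul_pos hκ0 (hpos _))] at key
  have hprod : ∀ m n : ℕ, nZ + 1 ≤ m + n → s ^ m * s ^ n ≤ s * s ^ nZ := fun m n h => by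
    rw [← pow_add, ← pow_succ']
    exact pow_le_pow_of_le_one h0.le hs1.le h
  have hbig : ∀ n : ℕ, nZ + 1 ≤ A + n → nZ + 1 ≤ B + n →
      (s ^ A + 2 * s ^ B) * s ^ n ≤ 3 * (s * s ^ nZ) := fun n ha hb => by
    linarith [hprod A n ha, hprod B n hb]
  have h3 : s ^ nZ ≤ 3 * C * (2 * c + e + a * 2 + b) * s * s ^ nZ :=
    calc s ^ nZ ≤ b * s ^ nZ := le_mul_of_one_le_left (hpos _).le hb'
      _ ≤ _ := key
      _ ≤ C * (s ^ A + 2 * s ^ B) * ((2 * c + e) * s ^ nX + a * 2 * s ^ nY + b * s ^ nZ) := by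
        gcongr
      _ = C * ((2 * c + e) * ((s ^ A + 2 * s ^ B) * s ^ nX)
          + a * 2 * ((s ^ A + 2 * s ^ B) * s ^ nY) + b * ((s ^ A + 2 * s ^ B) * s ^ nZ)) := by ring
      _ ≤ C * ((2 * c + e) * (3 * (s * s ^ nZ)) + a * 2 * (3 * (s * s ^ nZ))
          + b * (3 * (s * s ^ nZ))) := by
        refine mul_le_mul_of_nonneg_left (add_le_add (add_le_add ?_ ?_) ?_) hC.le
        · exact mul_le_mul_of_nonneg_left (hbig nX (by omega) (by omega)) (by positivity)
        · exact mul_le_mul_of_nonneg_left (hbig nY (by omega) (by omega)) (by positivity)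
        · exact mul_le_mul_of_nonneg_left (hbig nZ (by omega) (by omega)) (by positivity)
      _ = _ := by ring
  exact (le_mul_iff_one_le_left (hpos nZ)).1 h3

/-- What (L2) says about the points of the curve of `curve_gradient` and companion points
`(x', y', z')` at distance `O(s ^ m)`: the companion's normal vector has to be horizontal, or the
mirror image in `x` (or `y`) of that at the curve point, while the `x`-component (or `y`-component)
dominates the gradient along the curve. The inequality `1 ≤ K * s` is absurd for small `s`. -/
lemma MostowskiRegular.exists_curve_bounds {γ : ℝ} (hγ : 1 < γ) {a b c e : ℕ} (ha : 0 < a)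
    (hb : 0 < b) (hc : 0 < c) (he : 0 < e) (hreg : MostowskiRegular γ a b c (c + e)) :
    ∃ κ : ℝ, κ ^ a = 2 ∧ 1 ≤ κ ∧ κ ≤ 2 ∧ ∃ K δ : ℝ, 0 < δ ∧ δ ≤ 1 ∧
    ∀ s : ℝ, 0 < s → s < δ → ∀ x y z nx ny nz x' y' z' nx' ny' nz' : ℝ,
      x = s ^ (a * b) → y = κ * s ^ ((c + e) * b) → z = s ^ (a * e) →
      nx = c * z ^ b * x ^ (c - 1) + (c + e : ℕ) * x ^ (c + e - 1) →
      ny = a * y ^ (a - 1) → nz = b * z ^ (b - 1) * x ^ c →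
      y' ^ a = z' ^ b * x' ^ c + x' ^ (c + e) → (x' ≠ 0 ∨ y' ≠ 0) →
      |x'| + |y'| + |z'| ≤ 5 * s →
      nx' = c * z' ^ b * x' ^ (c - 1) + (c + e : ℕ) * x' ^ (c + e - 1) →
      ny' = a * y' ^ (a - 1) → nz' = b * z' ^ (b - 1) * x' ^ c →
      ∀ m : ℕ, |x - x'| + |y - y'| + |z - z'| ≤ 4 * s ^ m →
      (a * e + (c + e) * b ≤ a * b → (c + e) * b < m → a * b < a * e + m →
        (nx' = -nx ∧ ny' = ny ∧ nz' = nz ∨ 0 < nx' ^ 2 + ny' ^ 2 ∧ nz' = 0) → 1 ≤ K * s) ∧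
      (a * e + a * b ≤ (c + e) * b → a * b < m → (c + e) * b < a * e + m →
        (nx' = nx ∧ ny' = -ny ∧ nz' = nz ∨ 0 < nx' ^ 2 + ny' ^ 2 ∧ nz' = 0) → 1 ≤ K * s) := by
  obtain ⟨κ, hκ, hκ1, hκ2⟩ := exists_pow_eq_two ha
  obtain ⟨nX, nY, nZ, hX, hY, hZ, hcurve⟩ := curve_gradient ha hb hc e hκ
  obtain ⟨C, hC, ε, hε, H⟩ := hreg.exists_coord_bounds hγ
  have hκ' : κ ^ (a - 1) ≤ 2 := (pow_le_pow_right₀ hκ1 (Nat.sub_le a 1)).trans hκ.le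
  have hκ'' : 1 ≤ κ ^ (a - 1) := one_le_pow₀ hκ1
  have hA : 0 < a * b := by positivity
  have hB : 0 < (c + e) * b := by positivity
  have hE : 0 < a * e := by positivity
  have ha' : (1 : ℝ) ≤ a := by exact_mod_cast ha
  have hb' : (1 : ℝ) ≤ b := by exact_mod_cast hb
  have hc' : (1 : ℝ) ≤ c := by exact_mod_cast hc
  have he' : (0 : ℝ) ≤ e := Nat.cast_nonneg e
  generalize a * b = A at *
  generalize (c + e) * b = B at *
  generalize a * e = E at *
  refine ⟨κ, hκ, hκ1, hκ2, 3 * (4 * C) * (2 * c + e + a * 2 + b) ^ 2,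
    min (min 1 (ε / 5)) (1 / (8 * γ)), by positivity, (min_le_left _ _).trans (min_le_left _ _), ?_⟩
  intro s h0 hs x y z nx ny nz x' y' z' nx' ny' nz' hx hy hz hnx hny hnz hV' hne' hε' hnx' hny'
    hnz' m hdist
  have hs1 : s < 1 := hs.trans_le ((min_le_left _ _).trans (min_le_left _ _))
  have hsε : s < ε / 5 := hs.trans_le ((min_le_left _ _).trans (min_le_right _ _))
  have hsγ : s < 1 / (8 * γ) := hs.trans_le (min_le_right _ _)
  rw [lt_div_iff₀ (by positivity)] at hsγ
  have hpos : ∀ n, 0 < s ^ n := fun n => pow_pos h0 n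
  have hle : ∀ {n : ℕ}, 0 < n → s ^ n ≤ s := fun hn => pow_le_of_le_one h0.le hs1.le hn.ne'
  have hanti : ∀ {k n : ℕ}, k ≤ n → s ^ n ≤ s ^ k := fun hn =>
    pow_le_pow_of_le_one h0.le hs1.le hn
  obtain ⟨hV, hgx, hgy, hgz⟩ := hcurve s
  rw [← hx, ← hy, ← hz] at hV
  rw [← hx, ← hz, ← hnx] at hgx
  rw [← hy, ← hny] at hgy
  rw [← hx, ← hz, ← hnz] at hgz
  have hx0 : 0 < x := hx ▸ hpos A
  have hy0 : 0 < y := hy ▸ mul_pos (by linarith) (hpos B)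
  have hz0 : 0 < z := hz ▸ hpos E
  have hnx0 : 0 ≤ nx := by rw [← hgx]; positivity
  have hny0 : 0 ≤ ny := by rw [← hgy]; positivity
  have hnz0 : 0 < nz := by rw [← hgz]; exact mul_pos (by linarith) (hpos _)
  have hS : 0 < nx ^ 2 + ny ^ 2 + nz ^ 2 := by positivity
  have hsmall : |x| + |y| + |z| < ε := by
    rw [abs_of_pos hx0, abs_of_pos hy0, abs_of_pos hz0, hx, hy, hz]
    have := mul_le_mul hκ2 (hle hB) (hpos B).le zero_le_two
    linarith only [hle hA, hle hE, this, hsε, h0]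
  have hstep := (H x y z nx ny nz hV (Or.inl hx0.ne') hsmall hnx hny hnz hS).2
    x' y' z' nx' ny' nz' hV' hne' (by linarith only [hε', hsε]) hnx' hny' hnz'
  have hbx : |nx| ≤ (2 * c + e + a * 2 + b) * s ^ nX := by
    rw [abs_of_nonneg hnx0, ← hgx]
    exact mul_le_mul_of_nonneg_right (by linarith only [ha', hb']) (hpos _).le
  have hby : |ny| ≤ (2 * c + e + a * 2 + b) * s ^ nY := by
    rw [abs_of_nonneg hny0, ← hgy]
    refine mul_le_mul_of_nonneg_right ?_ (hpos _).le
    linarith only [mul_le_mul_of_nonneg_left hκ' (by positivity : (0 : ℝ) ≤ a), hb', hc', he']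
  have hbz : |nz| ≤ (2 * c + e + a * 2 + b) * s ^ nZ := by
    rw [abs_of_pos hnz0, ← hgz]
    exact mul_le_mul_of_nonneg_right (by linarith only [ha', hc', he']) (hpos _).le
  have hlx : s ^ nX ≤ |nx| := by
    rw [abs_of_nonneg hnx0, ← hgx]
    exact le_mul_of_one_le_left (hpos _).le (by linarith only [hc', he'])
  have hly : s ^ nY ≤ |ny| := by
    rw [abs_of_nonneg hny0, ← hgy]
    exact le_mul_of_one_le_left (hpos _).le (one_le_mul_of_one_le_of_one_le ha' hκ'')
  have hlz : s ^ nZ ≤ |nz| := by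
    rw [abs_of_pos hnz0, ← hgz]
    exact le_mul_of_one_le_left (hpos _).le hb'
  have hP : (0 : ℝ) ≤ 2 * c + e + a * 2 + b := by positivity
  have hmono : ∀ {k n : ℕ}, k ≤ n → (2 * c + e + a * 2 + b) * s ^ n
      ≤ (2 * c + e + a * 2 + b) * s ^ k := fun h => mul_le_mul_of_nonneg_left (hanti h) hP
  have hnear : ∀ k : ℕ, k < m → 2 * γ * (|x - x'| + |y - y'| + |z - z'|) ≤ s ^ k := by
    intro k hk
    have h3 : s ^ m ≤ s * s ^ k := by
      rw [← pow_succ']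
      exact hanti hk
    calc _ ≤ 2 * γ * (4 * (s * s ^ k)) := by
          refine mul_le_mul_of_nonneg_left (hdist.trans ?_) (by positivity)
          linarith only [h3]
      _ = s * (8 * γ) * s ^ k := by ring
      _ ≤ 1 * s ^ k := mul_le_mul_of_nonneg_right hsγ.le (hpos k).le
      _ = s ^ k := one_mul _
  have hfin : ∀ {t : ℝ}, t ≤ C * (|x - x'| + |y - y'| + |z - z'|) → t ≤ 4 * C * s ^ m := fun h =>
    h.trans ((mul_le_mul_of_nonneg_left hdist hC.le).trans (by linarith only))
  refine ⟨fun h1 h2 h3 h4 => ?_, fun h1 h2 h3 h4 => ?_⟩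
  · have hclose : 2 * γ * (|x - x'| + |y - y'| + |z - z'|) ≤ |y| := by
      refine (hnear B h2).trans ?_
      rw [abs_of_pos hy0, hy]
      exact le_mul_of_one_le_left (hpos _).le hκ1
    have hmain : |nz * nx / (nx ^ 2 + ny ^ 2 + nz ^ 2)|
        ≤ C * (|x - x'| + |y - y'| + |z - z'|) := by
      rcases h4 with ⟨rfl, rfl, rfl⟩ | ⟨hS', rfl⟩
      · have h5 := (hstep (by rw [neg_sq]; exact hS) (Or.inr hclose)).1
        rw [neg_sq, mul_neg, neg_div, sub_neg_eq_add, ← two_mul, abs_mul, abs_two] at h5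
        linarith only [h5, abs_nonneg (nz' * nx / (nx ^ 2 + ny' ^ 2 + nz' ^ 2))]
      · simpa using (hstep (by rw [zero_pow two_ne_zero, add_zero]; exact hS') (Or.inr hclose)).1
    exact one_le_mul_of_dominant h0 hs1 (by positivity) hbx (hby.trans (hmono (by omega)))
      (hbz.trans (hmono (by omega))) hlz hlx (hfin hmain) (by omega)
  · have hclose : 2 * γ * (|x - x'| + |y - y'| + |z - z'|) ≤ |x| := by
      refine (hnear A h2).trans ?_
      rw [abs_of_pos hx0, hx]
    have hmain : |nz * ny / (nx ^ 2 + ny ^ 2 + nz ^ 2)|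
        ≤ C * (|x - x'| + |y - y'| + |z - z'|) := by
      rcases h4 with ⟨rfl, rfl, rfl⟩ | ⟨hS', rfl⟩
      · have h5 := (hstep (by rw [neg_sq]; exact hS) (Or.inl hclose)).2
        rw [neg_sq, mul_neg, neg_div, sub_neg_eq_add, ← two_mul, abs_mul, abs_two] at h5
        linarith only [h5, abs_nonneg (nz' * ny / (nx' ^ 2 + ny ^ 2 + nz' ^ 2))]
      · simpa using (hstep (by rw [zero_pow two_ne_zero, add_zero]; exact hS') (Or.inl hclose)).2
    exact one_le_mul_of_dominant h0 hs1 (by positivity) (hbx.trans (hmono (by omega))) hby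
      (hbz.trans (hmono (by omega))) hlz hly (hfin hmain) (by omega)

/-- (L2) fails between the points `(±x, y, z)`. -/
theorem not_mostowskiRegular_of_even_x {γ : ℝ} (hγ : 1 < γ) {a b c e : ℕ} (ha : 0 < a)
    (hb : 0 < b) (hc : 0 < c) (he : 0 < e) (h : a * e + (c + e) * b ≤ a * b) (hce : Even c)
    (hee : Even e) : ¬ MostowskiRegular γ a b c (c + e) := by
  intro hreg
  obtain ⟨κ, hκ, hκ1, hκ2, K, δ, hδ, hδ1, H⟩ := hreg.exists_curve_bounds hγ ha hb hc he
  refine false_of_one_le_mul (K := K) hδ fun s h0 hs => ?_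
  have hcodd : Odd (c - 1) := Nat.Even.sub_odd hc hce odd_one
  have hdodd : Odd (c + e - 1) := Nat.Even.sub_odd (by omega) (hce.add hee) odd_one
  have hpos : ∀ n, 0 < s ^ n := fun n => pow_pos h0 n
  have hle : ∀ {n : ℕ}, 0 < n → s ^ n ≤ s := fun hn =>
    pow_le_of_le_one h0.le (hs.le.trans hδ1) hn.ne'
  have hA : 0 < a * b := by positivity
  have hB : 0 < (c + e) * b := by positivity
  have hE : 0 < a * e := by positivity
  have hV := ((curve_gradient ha hb hc e hκ).choose_spec.choose_spec.choose_spec.2.2.2 s).1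
  refine (H s h0 hs _ _ _ _ _ _ (-s ^ (a * b)) (κ * s ^ ((c + e) * b)) (s ^ (a * e)) _ _ _ rfl rfl
    rfl rfl rfl rfl ?_ (Or.inl (neg_ne_zero.2 (hpos _).ne')) ?_ rfl rfl rfl (a * b) ?_).1 h
    (by omega) (by omega) (Or.inl ⟨?_, rfl, ?_⟩)
  · rw [hce.neg_pow, (hce.add hee).neg_pow]
    exact hV
  · rw [abs_neg, abs_of_pos (hpos _), abs_of_pos (mul_pos (by linarith) (hpos _)),
      abs_of_pos (hpos _)]
    nlinarith [hle hA, hle hB, hle hE, hpos ((c + e) * b)]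
  · rw [sub_self, sub_self, abs_zero, add_zero, add_zero, sub_neg_eq_add, ← two_mul,
      abs_mul, abs_two, abs_of_pos (hpos _)]
    linarith [hpos (a * b)]
  · rw [hcodd.neg_pow, hdodd.neg_pow]
    ring
  · rw [hce.neg_pow]

/-- (L2) fails between the points `(x, ±y, z)`. -/
theorem not_mostowskiRegular_of_even_y {γ : ℝ} (hγ : 1 < γ) {a b c e : ℕ} (ha : 0 < a)
    (hb : 0 < b) (hc : 0 < c) (he : 0 < e) (h : a * e + a * b ≤ (c + e) * b) (hae : Even a) :
    ¬ MostowskiRegular γ a b c (c + e) := by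
  intro hreg
  obtain ⟨κ, hκ, hκ1, hκ2, K, δ, hδ, hδ1, H⟩ := hreg.exists_curve_bounds hγ ha hb hc he
  refine false_of_one_le_mul (K := K) hδ fun s h0 hs => ?_
  have haodd : Odd (a - 1) := Nat.Even.sub_odd ha hae odd_one
  have hpos : ∀ n, 0 < s ^ n := fun n => pow_pos h0 n
  have hle : ∀ {n : ℕ}, 0 < n → s ^ n ≤ s := fun hn =>
    pow_le_of_le_one h0.le (hs.le.trans hδ1) hn.ne'
  have hA : 0 < a * b := by positivity
  have hB : 0 < (c + e) * b := by positivity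
  have hE : 0 < a * e := by positivity
  have hV := ((curve_gradient ha hb hc e hκ).choose_spec.choose_spec.choose_spec.2.2.2 s).1
  have hy : 0 < κ * s ^ ((c + e) * b) := mul_pos (by linarith) (hpos _)
  refine (H s h0 hs _ _ _ _ _ _ (s ^ (a * b)) (-(κ * s ^ ((c + e) * b))) (s ^ (a * e)) _ _ _ rfl
    rfl rfl rfl rfl rfl ?_ (Or.inl (hpos _).ne') ?_ rfl rfl rfl ((c + e) * b) ?_).2 h
    (by omega) (by omega) (Or.inl ⟨rfl, ?_, rfl⟩)
  · rw [hae.neg_pow]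
    exact hV
  · rw [abs_neg, abs_of_pos (hpos _), abs_of_pos hy, abs_of_pos (hpos _)]
    nlinarith [hle hA, hle hB, hle hE, hpos ((c + e) * b)]
  · rw [sub_self, sub_self, abs_zero, add_zero, zero_add, sub_neg_eq_add, ← two_mul,
      abs_mul, abs_two, abs_of_pos hy]
    nlinarith [hpos ((c + e) * b)]
  · rw [haodd.neg_pow]
    ring

/-- For `d < a`, (L2) fails between a point of the curve of `curve_gradient` and the point of the
section `z = 0` with the same `y`. -/
theorem not_mostowskiRegular_of_zSection_x {γ : ℝ} (hγ : 1 < γ) {a b c e : ℕ} (ha : 0 < a)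
    (hb : 1 < b) (hc : 0 < c) (he : 0 < e) (h : a * e + (c + e) * b ≤ a * b) (hbe : b < 2 * e) :
    ¬ MostowskiRegular γ a b c (c + e) := by
  intro hreg
  obtain ⟨κ, hκ, hκ1, hκ2, K, δ, hδ, hδ1, H⟩ := hreg.exists_curve_bounds hγ ha (by omega) hc he
  obtain ⟨l, hl, hl1, hl2⟩ := exists_pow_eq_two (n := c + e) (by omega)
  refine false_of_one_le_mul (K := K) hδ fun s h0 hs => ?_
  have hpos : ∀ n, 0 < s ^ n := fun n => pow_pos h0 n
  have hle : ∀ {n : ℕ}, 0 < n → s ^ n ≤ s := fun hn =>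
    pow_le_of_le_one h0.le (hs.le.trans hδ1) hn.ne'
  have hA : 0 < a * b := by positivity
  have hB : 0 < (c + e) * b := by positivity
  have hE : 0 < a * e := by positivity
  have hAE : a * b < 2 * (a * e) := by nlinarith
  have hy : 0 < κ * s ^ ((c + e) * b) := mul_pos (by linarith) (hpos _)
  have hx : 0 < l * s ^ (a * b) := mul_pos (by linarith) (hpos _)
  refine (H s h0 hs _ _ _ _ _ _ (l * s ^ (a * b)) (κ * s ^ ((c + e) * b)) 0 _ _ _ rfl rfl
    rfl rfl rfl rfl ?_ (Or.inl hx.ne') ?_ rfl rfl rfl (a * e) ?_).1 h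
    (by omega) (by omega) (Or.inr ⟨?_, ?_⟩)
  · rw [mul_pow, mul_pow _ _ (c + e), hκ, hl, zero_pow (by omega)]
    ring
  · rw [abs_of_pos hx, abs_of_pos hy, abs_zero]
    nlinarith [hle hA, hle hB, hpos ((c + e) * b), hpos (a * b)]
  · have h1 : s ^ (a * b) ≤ s ^ (a * e) :=
      pow_le_pow_of_le_one h0.le (hs.le.trans hδ1) (by omega)
    have h2 : |s ^ (a * b) - l * s ^ (a * b)| ≤ s ^ (a * b) := by
      rw [abs_le]
      constructor <;> nlinarith [hpos (a * b)]
    rw [sub_self, abs_zero, add_zero, sub_zero, abs_of_pos (hpos (a * e))]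
    linarith [hpos (a * e)]
  · have : 0 < (a : ℝ) * (κ * s ^ ((c + e) * b)) ^ (a - 1) := by positivity
    positivity
  · rw [zero_pow (by omega)]
    ring

/-- For `d > a`, (L2) fails between a point of the curve of `curve_gradient` and the point of the
section `z = 0` with the same `x`. -/
theorem not_mostowskiRegular_of_zSection_y {γ : ℝ} (hγ : 1 < γ) {a b c e : ℕ} (ha : 0 < a)
    (hb : 1 < b) (hc : 0 < c) (he : 0 < e) (h : a * e + a * b ≤ (c + e) * b)
    (hbe : (c + e) * b < 2 * (a * e)) : ¬ MostowskiRegular γ a b c (c + e) := by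
  intro hreg
  obtain ⟨κ, hκ, hκ1, hκ2, K, δ, hδ, hδ1, H⟩ := hreg.exists_curve_bounds hγ ha (by omega) hc he
  refine false_of_one_le_mul (K := K) hδ fun s h0 hs => ?_
  have hpos : ∀ n, 0 < s ^ n := fun n => pow_pos h0 n
  have hle : ∀ {n : ℕ}, 0 < n → s ^ n ≤ s := fun hn =>
    pow_le_of_le_one h0.le (hs.le.trans hδ1) hn.ne'
  have hA : 0 < a * b := by positivity
  have hB : 0 < (c + e) * b := by positivity
  have hE : 0 < a * e := by positivity
  refine (H s h0 hs _ _ _ _ _ _ (s ^ (a * b)) (s ^ ((c + e) * b)) 0 _ _ _ rfl rfl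
    rfl rfl rfl rfl ?_ (Or.inl (hpos _).ne') ?_ rfl rfl rfl (a * e) ?_).2 h
    (by omega) (by omega) (Or.inr ⟨?_, ?_⟩)
  · rw [zero_pow (by omega)]
    ring
  · rw [abs_of_pos (hpos _), abs_of_pos (hpos _), abs_zero]
    linarith [hle hA, hle hB]
  · have h1 : s ^ ((c + e) * b) ≤ s ^ (a * e) :=
      pow_le_pow_of_le_one h0.le (hs.le.trans hδ1) (by omega)
    have h2 : |κ * s ^ ((c + e) * b) - s ^ ((c + e) * b)| ≤ s ^ ((c + e) * b) := by
      rw [abs_le]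
      constructor <;> nlinarith [hpos ((c + e) * b)]
    rw [sub_self, abs_zero, zero_add, sub_zero, abs_of_pos (hpos (a * e))]
    linarith [hpos (a * e)]
  · have : 0 < (a : ℝ) * (s ^ ((c + e) * b)) ^ (a - 1) := by positivity
    positivity
  · rw [zero_pow (by omega)]
    ring

/-- For `c < a < d`, (L1) fails along the curve `x = y`, where the surface turns from its steep
part near the axis to its flat part. -/
theorem not_mostowskiRegular_of_diagonal {γ : ℝ} (hγ : 1 < γ) {a b c d : ℕ} (hb : 0 < b)
    (hc : 0 < c) (hca : c < a) (had : a < d) : ¬ MostowskiRegular γ a b c d := by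
  intro hreg
  obtain ⟨C, hC, ε, hε, H⟩ := hreg.exists_coord_bounds hγ
  set K : ℝ := 4 * C * (c + d + a) with hK
  have hK0 : 0 < K := by positivity
  have hb' : (1 : ℝ) ≤ b := by exact_mod_cast hb
  refine false_of_one_le_mul (K := 2 * K) (δ := min (1 / 2) (min (ε / 3) (1 / (4 * C))))
    (by positivity) fun s h0 hs => ?_
  have hs2 : s < 1 / 2 := hs.trans_le (min_le_left _ _)
  have hsε : s < ε / 3 := hs.trans_le ((min_le_right _ _).trans (min_le_left _ _))
  have hsC : s < 1 / (4 * C) := hs.trans_le ((min_le_right _ _).trans (min_le_right _ _))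
  rw [lt_div_iff₀ (by positivity)] at hsC
  set x := s ^ b with hx
  have hx0 : 0 < x := pow_pos h0 b
  have hxs : x ≤ s := pow_le_of_le_one h0.le (by linarith) hb.ne'
  have hw : x ^ (d - a) ≤ 1 / 2 :=
    (pow_le_of_le_one hx0.le (by linarith) (by omega)).trans (by linarith)
  set w := x ^ (a - c) * (1 - x ^ (d - a)) with hwdef
  have hw0 : 0 < w := mul_pos (pow_pos hx0 _) (by linarith)
  have hwx : w ≤ x :=
    calc w ≤ x ^ (a - c) * 1 := by
          refine mul_le_mul_of_nonneg_left ?_ (pow_pos hx0 _).le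
          linarith only [pow_pos hx0 (d - a)]
      _ ≤ x := by
          rw [mul_one]
          exact pow_le_of_le_one hx0.le (by linarith) (by omega)
  obtain ⟨z, hz0, hzb⟩ : ∃ z : ℝ, 0 < z ∧ z ^ b = w :=
    ⟨w ^ ((b : ℝ)⁻¹), Real.rpow_pos_of_pos hw0 _, Real.rpow_inv_natCast_pow hw0.le hb.ne'⟩
  have hzs : z ≤ s := by
    rw [← pow_le_pow_iff_left₀ hz0.le h0.le hb.ne', hzb]
    exact hwx
  have hxa : x ^ a = x ^ (a - c) * x ^ c := by rw [← pow_add, Nat.sub_add_cancel hca.le]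
  have hxd : x ^ d = x ^ (d - a) * x ^ a := by rw [← pow_add, Nat.sub_add_cancel had.le]
  have hV : x ^ a = z ^ b * x ^ c + x ^ d := by
    rw [hzb, hwdef, hxd, hxa]
    ring
  have hcpos : 0 < x ^ c := pow_pos hx0 c
  have hapos : 0 < x ^ a := pow_pos hx0 a
  have hpred : ∀ n : ℕ, 0 < n → x ^ (n - 1) * x = x ^ n := fun n hn => by
    rw [← pow_succ, Nat.sub_add_cancel hn]
  have hzpred : z ^ (b - 1) * z = z ^ b := by rw [← pow_succ, Nat.sub_add_cancel hb]
  have hnx : 0 ≤ c * z ^ b * x ^ (c - 1) + d * x ^ (d - 1) := by positivity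
  have hny : 0 < a * x ^ (a - 1) := by
    have : (0 : ℝ) < a := by exact_mod_cast (by omega : 0 < a)
    positivity
  have hnz : 0 < b * z ^ (b - 1) * x ^ c := by positivity
  have key := (H x x z _ _ _ hV (Or.inl hx0.ne') (by
    rw [abs_of_pos hx0, abs_of_pos hz0]
    linarith only [hxs, hzs, hsε]) rfl rfl rfl (by positivity)).1
  rw [abs_of_pos hx0, abs_of_nonneg hnx, abs_of_pos hny, abs_of_pos hnz] at key
  have hda : x ^ d ≤ x ^ a := by
    rw [hxd]
    exact mul_le_of_le_one_left hapos.le (by linarith only [hw])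
  have hzc : z ^ b * x ^ c ≤ x ^ a := by linarith only [hV, pow_pos hx0 d]
  -- multiplying the first two components by `x` turns them into multiples of `x ^ a`
  have hsum : 2 * x * (c * z ^ b * x ^ (c - 1) + d * x ^ (d - 1) + a * x ^ (a - 1))
      ≤ 2 * (c + d + a) * x ^ a := by
    have h1 : 2 * x * (c * z ^ b * x ^ (c - 1) + d * x ^ (d - 1) + a * x ^ (a - 1))
        = 2 * (c * (z ^ b * x ^ c) + d * x ^ d + a * x ^ a) := by
      rw [← hpred c hc, ← hpred d (by omega), ← hpred a (by omega)]
      ring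
    have h2 : (c : ℝ) * (z ^ b * x ^ c) ≤ c * x ^ a := by gcongr
    have h3 : (d : ℝ) * x ^ d ≤ d * x ^ a := by gcongr
    rw [h1]
    linarith only [h2, h3]
  have hnz2 : b * z ^ (b - 1) * x ^ c ≤ K * x ^ a := by
    have h1 : C * (x + x) * (b * z ^ (b - 1) * x ^ c) ≤ 1 / 2 * (b * z ^ (b - 1) * x ^ c) := by
      refine mul_le_mul_of_nonneg_right ?_ hnz.le
      linarith only [mul_le_mul_of_nonneg_left hxs hC.le, hsC]
    have h2 := mul_le_mul_of_nonneg_left hsum hC.le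
    rw [hK]
    linarith only [key, h1, h2]
  have h1 : 1 / 2 * x ^ a ≤ z ^ b * x ^ c := by
    have : x ^ d ≤ 1 / 2 * x ^ a := by
      rw [hxd]
      exact mul_le_mul_of_nonneg_right hw hapos.le
    linarith only [this, hV]
  have h2 : z ^ b * x ^ c ≤ K * z * x ^ a :=
    calc z ^ b * x ^ c ≤ b * (z ^ b * x ^ c) :=
          le_mul_of_one_le_left (by positivity) hb'
      _ = b * z ^ (b - 1) * x ^ c * z := by rw [← hzpred]; ring
      _ ≤ K * x ^ a * z := mul_le_mul_of_nonneg_right hnz2 hz0.le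
      _ = _ := by ring
  have h3 : 1 / 2 ≤ K * z := le_of_mul_le_mul_right (h1.trans h2) hapos
  linarith only [h3, mul_le_mul_of_nonneg_left hzs hK0.le]

/-! ### Regularity of surfaces with a smooth or cuspidal product structure -/

lemma surfaceGrad_apply_zero (a b c d : ℕ) (q : EuclideanSpace ℝ (Fin 3)) :
    surfaceGrad a b c d q 0 = -(c * q 2 ^ b * q 0 ^ (c - 1) + d * q 0 ^ (d - 1)) := rfl

lemma surfaceGrad_apply_one (a b c d : ℕ) (q : EuclideanSpace ℝ (Fin 3)) :
    surfaceGrad a b c d q 1 = a * q 1 ^ (a - 1) := rfl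

lemma surfaceGrad_apply_two (a b c d : ℕ) (q : EuclideanSpace ℝ (Fin 3)) :
    surfaceGrad a b c d q 2 = -(b * q 2 ^ (b - 1) * q 0 ^ c) := rfl

lemma contDiff_coord (i : Fin 3) : ContDiff ℝ 1 (fun v : EuclideanSpace ℝ (Fin 3) => v i) :=
  (EuclideanSpace.proj i : EuclideanSpace ℝ (Fin 3) →L[ℝ] ℝ).contDiff

lemma ContDiffAt.exists_lipschitz_ball {F : Type*} [NormedAddCommGroup F] [NormedSpace ℝ F]
    {f : EuclideanSpace ℝ (Fin 3) → F} (hf : ContDiffAt ℝ 1 f 0) :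
    ∃ K : ℝ, 0 ≤ K ∧ ∃ δ > 0, ∀ q q' : EuclideanSpace ℝ (Fin 3), ‖q‖ < δ → ‖q'‖ < δ →
      ‖f q - f q'‖ ≤ K * ‖q - q'‖ ∧ ‖f q‖ ≤ K := by
  obtain ⟨K, t, ht, hK⟩ := hf.exists_lipschitzOnWith
  obtain ⟨δ, hδ, hball⟩ := Metric.mem_nhds_iff.1 ht
  have hmem : ∀ q : EuclideanSpace ℝ (Fin 3), ‖q‖ < min δ 1 → q ∈ t := fun q hq =>
    hball (by rw [mem_ball_zero_iff]; exact hq.trans_le (min_le_left _ _))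
  refine ⟨K + ‖f 0‖, by positivity, min δ 1, by positivity, fun q q' hq hq' => ⟨?_, ?_⟩⟩
  · refine (hK.norm_sub_le (hmem q hq) (hmem q' hq')).trans ?_
    gcongr
    exact le_add_of_nonneg_right (norm_nonneg _)
  · have h1 := hK.norm_sub_le (hmem q hq) (hmem 0 (by rw [norm_zero]; positivity))
    have h2 : ‖q‖ ≤ 1 := hq.le.trans (min_le_right _ _)
    rw [sub_zero] at h1
    have h3 : ‖f q‖ ≤ ‖f q - f 0‖ + ‖f 0‖ := by
      simpa using norm_add_le (f q - f 0) (f 0)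
    nlinarith [K.coe_nonneg]

/-- For `a = 1` the surface is the graph of a polynomial. -/
theorem mostowskiRegular_of_graph {γ : ℝ} (hγ : 1 < γ) {b c d : ℕ} (hc : 0 < c) (hd : 0 < d) :
    MostowskiRegular γ 1 b c d := by
  have hsmooth : ContDiff ℝ 1 (surfaceGrad 1 b c d) := by
    rw [contDiff_euclidean]
    intro i
    have h := contDiff_coord
    fin_cases i
    · exact (((contDiff_const.mul ((h 2).pow b)).mul ((h 0).pow (c - 1))).add
        (contDiff_const.mul ((h 0).pow (d - 1)))).neg
    · exact contDiff_const.mul ((h 1).pow 0)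
    · exact ((contDiff_const.mul ((h 2).pow (b - 1))).mul ((h 0).pow c)).neg
  obtain ⟨K, hK, δ, hδ, H⟩ := hsmooth.contDiffAt.exists_lipschitz_ball
  refine mostowskiRegular_of_normalField hγ one_pos hc hd (ε := min δ 1) (by positivity) hK
    (surfaceGrad 1 b c d) fun q hq hqε => ?_
  have hqδ : ‖q‖ < δ := hqε.trans_le (min_le_left _ _)
  have hcomp : ∀ q' : EuclideanSpace ℝ (Fin 3), ‖q'‖ < δ →
      |surfaceGrad 1 b c d q 2 - surfaceGrad 1 b c d q' 2| ≤ K * ‖q - q'‖ := fun q' hq' =>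
    (abs_apply_le_norm (surfaceGrad 1 b c d q - surfaceGrad 1 b c d q') 2).trans
      (H q q' hqδ hq').1
  refine ⟨⟨1, one_ne_zero, (one_smul _ _).symm⟩, ?_, ?_, fun q' hq' hq'ε hqq' => ⟨?_, ?_⟩⟩
  · refine le_trans ?_ (abs_apply_le_norm _ 1)
    simp [surfaceGrad_apply_one]
  · have h1 := hcomp (axisFoot q) ((norm_axisFoot_le q).trans_lt hqδ)
    have h2 : surfaceGrad 1 b c d (axisFoot q) 2 = 0 := by
      simp [surfaceGrad_apply_two, axisFoot, hc.ne']
    rwa [h2, sub_zero, norm_sub_axisFoot] at h1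
  · have h1 := (H q q' hqδ (hq'ε.trans_le (min_le_left _ _))).1
    have h2 : axisDist q ≤ 1 := (axisDist_le_norm q).trans (hqε.le.trans (min_le_right _ _))
    exact (mul_le_of_le_one_left (norm_nonneg _) h2).trans h1
  · exact hcomp q' (hq'ε.trans_le (min_le_left _ _))

/-- Regularity of a surface whose normal direction, over the coordinate `s` of the normal plane of
the axis, is `1` in the other coordinate `t`, `(q t / q s) * h q` in the coordinate `s` and
`q t * g q` along the axis, where `g`, `h` are `C¹` near `0` and `q t = O(q s)`. -/
lemma mostowskiRegular_of_quotient {γ : ℝ} (hγ : 1 < γ) {a b c d : ℕ} (ha : 0 < a) (hc : 0 < c)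
    (hd : 0 < d) {s t : Fin 3} (hst : s = 0 ∧ t = 1 ∨ s = 1 ∧ t = 0)
    {g h : EuclideanSpace ℝ (Fin 3) → ℝ} (hg : ContDiffAt ℝ 1 g 0) (hh : ContDiffAt ℝ 1 h 0)
    {ε : ℝ} (hε : 0 < ε)
    (hq : ∀ q ∈ surfaceV a b c d \ axisOz, ‖q‖ < ε → q s ≠ 0 ∧ |q t| ≤ 2 * |q s| ∧
      ∃ r : ℝ, r ≠ 0 ∧ surfaceGrad a b c d q s = r * (q t / q s * h q) ∧
        surfaceGrad a b c d q t = r ∧ surfaceGrad a b c d q 2 = r * (q t * g q)) :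
    MostowskiRegular γ a b c d := by
  obtain ⟨Kg, hKg, δg, hδg, Hg⟩ := hg.exists_lipschitz_ball
  obtain ⟨Kh, hKh, δh, hδh, Hh⟩ := hh.exists_lipschitz_ball
  let ν : EuclideanSpace ℝ (Fin 3) → EuclideanSpace ℝ (Fin 3) := fun q =>
    WithLp.toLp 2 fun i => if i = 2 then q t * g q else if i = t then 1 else q t / q s * h q
  have hν2 : ∀ q, ν q 2 = q t * g q := fun q => rfl
  have hs2 : s ≠ 2 := by rcases hst with ⟨rfl, rfl⟩ | ⟨rfl, rfl⟩ <;> decide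
  have ht2 : t ≠ 2 := by rcases hst with ⟨rfl, rfl⟩ | ⟨rfl, rfl⟩ <;> decide
  have hst' : s ≠ t := by rcases hst with ⟨rfl, rfl⟩ | ⟨rfl, rfl⟩ <;> decide
  have hνt : ∀ q, ν q t = 1 := fun q => by simp [ν, ht2]
  have hνs : ∀ q, ν q s = q t / q s * h q := fun q => by simp [ν, hs2, hst']
  have hsum : ∀ v : EuclideanSpace ℝ (Fin 3), ‖v‖ ≤ |v s| + |v t| + |v 2| := by
    intro v
    have := norm_le_abs_add_abs_add_abs v
    rcases hst with ⟨rfl, rfl⟩ | ⟨rfl, rfl⟩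
    · exact this
    · linarith
  have hax : ∀ v : EuclideanSpace ℝ (Fin 3), axisDist v ≤ |v s| + |v t| := by
    intro v
    have := axisDist_le_abs_add_abs v
    rcases hst with ⟨rfl, rfl⟩ | ⟨rfl, rfl⟩
    · exact this
    · linarith
  have hax' : ∀ v : EuclideanSpace ℝ (Fin 3), |v t| ≤ axisDist v := by
    intro v
    rcases hst with ⟨rfl, rfl⟩ | ⟨rfl, rfl⟩
    · exact abs_one_le_axisDist v
    · exact abs_zero_le_axisDist v
  set ε' := min (min ε 1) (min δg δh) with hε'
  refine mostowskiRegular_of_normalField hγ ha hc hd (ε := ε') (K := 15 * Kh + 6 * Kg)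
    (by positivity) (by positivity) ν fun q hqV hqε => ?_
  have hε1 : ε' ≤ ε := (min_le_left _ _).trans (min_le_left _ _)
  have hε2 : ε' ≤ 1 := (min_le_left _ _).trans (min_le_right _ _)
  have hε3 : ε' ≤ δg := (min_le_right _ _).trans (min_le_left _ _)
  have hε4 : ε' ≤ δh := (min_le_right _ _).trans (min_le_right _ _)
  obtain ⟨hqs, hqts, r, hr, hrs, hrt, hr2⟩ := hq q hqV (hqε.trans_le hε1)
  refine ⟨⟨r, hr, ?_⟩, ?_, ?_, fun q' hq'V hq'ε _ => ?_⟩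
  · have key : ∀ i, i = s ∨ i = t ∨ i = 2 → surfaceGrad a b c d q i = r * ν q i := by
      rintro i (rfl | rfl | rfl)
      · rw [hrs, hνs]
      · rw [hrt, hνt, mul_one]
      · rw [hr2, hν2]
    ext i
    refine key i ?_
    rcases hst with ⟨rfl, rfl⟩ | ⟨rfl, rfl⟩ <;> fin_cases i <;> simp
  · refine le_trans ?_ (abs_apply_le_norm _ t)
    rw [hνt, abs_one]
  · have h1 := (Hg q q (hqε.trans_le hε3) (hqε.trans_le hε3)).2
    rw [Real.norm_eq_abs] at h1
    rw [hν2, abs_mul]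
    calc |q t| * |g q| ≤ axisDist q * Kg :=
          mul_le_mul (hax' q) h1 (abs_nonneg _) (axisDist_nonneg q)
      _ ≤ (15 * Kh + 6 * Kg) * axisDist q := by nlinarith [axisDist_nonneg q]
  · obtain ⟨hqs', hqts', -⟩ := hq q' hq'V (hq'ε.trans_le hε1)
    obtain ⟨Hg1, Hg2⟩ := Hg q q' (hqε.trans_le hε3) (hq'ε.trans_le hε3)
    obtain ⟨Hh1, -⟩ := Hh q q' (hqε.trans_le hε4) (hq'ε.trans_le hε4)
    obtain ⟨-, Hh2⟩ := Hh q' q (hq'ε.trans_le hε4) (hqε.trans_le hε4)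
    rw [Real.norm_eq_abs] at Hg1 Hg2 Hh1 Hh2
    have hds : |q s - q' s| ≤ ‖q - q'‖ := abs_apply_le_norm (q - q') s
    have hdt : |q t - q' t| ≤ ‖q - q'‖ := abs_apply_le_norm (q - q') t
    have hqt1 : |q t| ≤ 1 := (abs_apply_le_norm q t).trans (hqε.le.trans hε2)
    have hqs1 : |q s| ≤ 1 := (abs_apply_le_norm q s).trans (hqε.le.trans hε2)
    have hqt1' : |q' t| ≤ 1 := (abs_apply_le_norm q' t).trans (hq'ε.le.trans hε2)
    have hs0 : 0 < |q s| := abs_pos.2 hqs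
    have hs0' : 0 < |q' s| := abs_pos.2 hqs'
    set D := ‖q - q'‖ with hD
    have hD0 : 0 ≤ D := norm_nonneg _
    have hlast : |ν q 2 - ν q' 2| ≤ 2 * Kg * D := by
      rw [hν2, hν2, show q t * g q - q' t * g q' = (q t - q' t) * g q + q' t * (g q - g q') by ring]
      refine (abs_add_le _ _).trans ?_
      rw [abs_mul, abs_mul]
      calc _ ≤ D * Kg + 1 * (Kg * D) := by gcongr
        _ = _ := by ring
    have hquot : |q s| * |q t / q s - q' t / q' s| ≤ 3 * D := by
      rw [← abs_mul, show q s * (q t / q s - q' t / q' s)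
        = (q t - q' t) - q' t / q' s * (q s - q' s) by field_simp; ring]
      refine (abs_sub _ _).trans ?_
      have : |q' t / q' s| ≤ 2 := by
        rw [abs_div, div_le_iff₀ hs0']
        exact hqts'
      rw [abs_mul]
      calc _ ≤ D + 2 * D := by gcongr
        _ = _ := by ring
    have hfirst : |q s| * |ν q s - ν q' s| ≤ 5 * Kh * D := by
      rw [hνs, hνs, show q t / q s * h q - q' t / q' s * h q'
        = (q t / q s - q' t / q' s) * h q' + q t / q s * (h q - h q') by ring]
      have h1 : |q t / q s| ≤ 2 := by
        rw [abs_div, div_le_iff₀ hs0]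
        exact hqts
      calc _ ≤ |q s| * (|q t / q s - q' t / q' s| * |h q'| + |q t / q s| * |h q - h q'|) := by
            gcongr
            refine (abs_add_le _ _).trans ?_
            rw [abs_mul, abs_mul]
        _ = |q s| * |q t / q s - q' t / q' s| * |h q'| + |q s| * (|q t / q s| * |h q - h q'|) := by
            ring
        _ ≤ 3 * D * Kh + 1 * (2 * (Kh * D)) := by gcongr
        _ = _ := by ring
    refine ⟨?_, hlast.trans ?_⟩
    · have h1 := hsum (ν q - ν q')
      simp only [PiLp.sub_apply] at h1
      rw [hνt, hνt, sub_self, abs_zero, add_zero] at h1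
      have h2 : axisDist q ≤ 3 * |q s| := by linarith [hax q]
      calc axisDist q * ‖ν q - ν q'‖
          ≤ 3 * |q s| * (|ν q s - ν q' s| + |ν q 2 - ν q' 2|) := by gcongr
        _ = 3 * (|q s| * |ν q s - ν q' s|) + 3 * (|q s| * |ν q 2 - ν q' 2|) := by ring
        _ ≤ 3 * (5 * Kh * D) + 3 * (1 * (2 * Kg * D)) := by gcongr
        _ = _ := by ring
    · gcongr
      linarith

/-- For `d ≤ c` the surface is `y ^ a = x ^ d * u` with a unit `u`, a product of a cusp with the
axis. -/
theorem mostowskiRegular_of_cusp {γ : ℝ} (hγ : 1 < γ) {a b c d : ℕ} (ha : 0 < a) (hb : 0 < b)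
    (hd : 0 < d) (hdc : d ≤ c) : MostowskiRegular γ a b c d := by
  obtain ⟨k, rfl⟩ := Nat.exists_eq_add_of_le hdc
  have hcoord := contDiff_coord
  have ha' : (0 : ℝ) < a := by exact_mod_cast ha
  have hd' : (0 : ℝ) < d := by exact_mod_cast hd
  let u : EuclideanSpace ℝ (Fin 3) → ℝ := fun q => 1 + q 2 ^ b * q 0 ^ k
  let w : EuclideanSpace ℝ (Fin 3) → ℝ := fun q => d + (d + k : ℕ) * (q 2 ^ b * q 0 ^ k)
  have hu : ContDiff ℝ 1 u := contDiff_const.add (((hcoord 2).pow b).mul ((hcoord 0).pow k))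
  have hw : ContDiff ℝ 1 w :=
    contDiff_const.add (contDiff_const.mul (((hcoord 2).pow b).mul ((hcoord 0).pow k)))
  have hv : ContDiff ℝ 1 fun q : EuclideanSpace ℝ (Fin 3) => b * q 2 ^ (b - 1) * q 0 ^ k :=
    (contDiff_const.mul ((hcoord 2).pow (b - 1))).mul ((hcoord 0).pow k)
  have hu0 : u 0 = 1 := by simp [u, hb.ne']
  have hw0 : w 0 = d := by simp [w, hb.ne']
  obtain ⟨ε, hε, hball⟩ : ∃ ε > 0, ∀ q : EuclideanSpace ℝ (Fin 3), ‖q‖ < ε →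
      1 / 2 ≤ u q ∧ u q ≤ 2 ∧ 0 < w q ∧ ‖q‖ ≤ 1 := by
    have h1 : ∀ᶠ q in nhds (0 : EuclideanSpace ℝ (Fin 3)),
        1 / 2 ≤ u q ∧ u q ≤ 2 ∧ 0 < w q ∧ ‖q‖ ≤ 1 := by
      have hcu := hu.continuous.continuousAt (x := 0)
      have hcw := hw.continuous.continuousAt (x := 0)
      have hcn := continuous_norm.continuousAt (x := (0 : EuclideanSpace ℝ (Fin 3)))
      filter_upwards [hcu.eventually (lt_mem_nhds (by rw [hu0]; norm_num : 1 / 2 < u 0)),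
        hcu.eventually (gt_mem_nhds (by rw [hu0]; norm_num : u 0 < 2)),
        hcw.eventually (lt_mem_nhds (by rw [hw0]; exact hd' : 0 < w 0)),
        hcn.eventually (gt_mem_nhds (by rw [norm_zero]; norm_num :
          ‖(0 : EuclideanSpace ℝ (Fin 3))‖ < 1))] with q h1 h2 h3 h4
      exact ⟨h1.le, h2.le, h3, h4.le⟩
    obtain ⟨ε, hε, h⟩ := Metric.mem_nhds_iff.1 h1
    exact ⟨ε, hε, fun q hq => h (by rwa [mem_ball_zero_iff])⟩
  have hsurf : ∀ q ∈ surfaceV a b (d + k) d, q 1 ^ a = q 0 ^ d * u q := by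
    intro q hq
    rw [show q 1 ^ a = q 2 ^ b * q 0 ^ (d + k) + q 0 ^ d from hq]
    simp only [u]
    ring
  have hne : ∀ q ∈ surfaceV a b (d + k) d \ axisOz, ‖q‖ < ε → q 0 ≠ 0 ∧ q 1 ≠ 0 := by
    intro q hq hqε
    have h1 := hsurf q hq.1
    have h2 : u q ≠ 0 := by linarith [(hball q hqε).1]
    constructor
    · intro h3
      rw [h3, zero_pow hd.ne', zero_mul] at h1
      exact hq.2 ⟨h3, pow_eq_zero_iff ha.ne' |>.1 h1⟩
    · intro h3
      rw [h3, zero_pow ha.ne', eq_comm, mul_eq_zero, or_iff_left h2] at h1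
      exact hq.2 ⟨pow_eq_zero_iff hd.ne' |>.1 h1, h3⟩
  have hgx : ∀ q : EuclideanSpace ℝ (Fin 3), q 0 ≠ 0 →
      surfaceGrad a b (d + k) d q 0 = -(q 0 ^ (d - 1) * w q) := by
    intro q hq
    rw [surfaceGrad_apply_zero, show d + k - 1 = d - 1 + k by omega, pow_add]
    simp only [w]
    ring
  have habs : ∀ q ∈ surfaceV a b (d + k) d, ‖q‖ < ε → |q 1| ^ a = |q 0| ^ d * u q := by
    intro q hq hqε
    rw [← abs_pow, hsurf q hq, abs_mul, abs_pow,
      abs_of_pos (show 0 < u q by linarith [(hball q hqε).1])]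
  rcases le_or_gt a d with had | hda
  · refine mostowskiRegular_of_quotient hγ ha (by omega) hd (s := 0) (t := 1)
      (Or.inl ⟨rfl, rfl⟩) (g := fun q => -(b * q 2 ^ (b - 1) * q 0 ^ k / (a * u q)))
      (h := fun q => -(w q / (a * u q))) ?_ ?_ hε fun q hq hqε => ?_
    · exact (hv.contDiffAt.div (contDiffAt_const.mul hu.contDiffAt)
        (by rw [hu0, mul_one]; exact ha'.ne')).neg
    · exact (hw.contDiffAt.div (contDiffAt_const.mul hu.contDiffAt)
        (by rw [hu0, mul_one]; exact ha'.ne')).neg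
    · obtain ⟨hx, hy⟩ := hne q hq hqε
      obtain ⟨hu1, hu2, hw1, hq1⟩ := hball q hqε
      have hupos : u q ≠ 0 := by linarith
      have hx1 : |q 0| ≤ 1 := (abs_apply_le_norm q 0).trans hq1
      have hya : q 1 ^ a = q 1 ^ (a - 1) * q 1 := by rw [← pow_succ, Nat.sub_add_cancel ha]
      have hxd : q 0 ^ d = q 0 ^ (d - 1) * q 0 := by rw [← pow_succ, Nat.sub_add_cancel hd]
      have hV := hsurf q hq.1
      refine ⟨hx, ?_, a * q 1 ^ (a - 1), mul_ne_zero ha'.ne' (pow_ne_zero _ hy), ?_, rfl, ?_⟩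
      · rw [← pow_le_pow_iff_left₀ (abs_nonneg _) (by positivity) ha.ne', habs q hq.1 hqε, mul_pow]
        calc |q 0| ^ d * u q ≤ |q 0| ^ a * 2 := by
              gcongr ?_ * ?_
              exact pow_le_pow_of_le_one (abs_nonneg _) hx1 had
          _ = 2 ^ 1 * |q 0| ^ a := by ring
          _ ≤ 2 ^ a * |q 0| ^ a := by
              gcongr
              · norm_num
              · exact ha
      · rw [hgx q hx]
        have h1 : q 1 ^ (a - 1) * q 1 = q 0 ^ (d - 1) * q 0 * u q := by rw [← hya, ← hxd, hV]
        have h2 : a * q 1 ^ (a - 1) * (q 1 / q 0 * -(w q / (a * u q)))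
            = -(q 1 ^ (a - 1) * q 1 * w q / (q 0 * u q)) := by field_simp
        rw [h2, h1]
        field_simp
      · rw [surfaceGrad_apply_two]
        have h1 : q 1 ^ (a - 1) * q 1 = q 0 ^ d * u q := by rw [← hya, hV]
        have h2 : a * q 1 ^ (a - 1) * (q 1 * -(b * q 2 ^ (b - 1) * q 0 ^ k / (a * u q)))
            = -(b * q 2 ^ (b - 1) * q 0 ^ k * (q 1 ^ (a - 1) * q 1) / u q) := by field_simp
        rw [h2, h1, pow_add]
        field_simp
  · refine mostowskiRegular_of_quotient hγ ha (by omega) hd (s := 1) (t := 0)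
      (Or.inr ⟨rfl, rfl⟩) (g := fun q => b * q 2 ^ (b - 1) * q 0 ^ k / w q)
      (h := fun q => -(a * u q / w q)) ?_ ?_ hε fun q hq hqε => ?_
    · exact hv.contDiffAt.div hw.contDiffAt (by rw [hw0]; exact hd'.ne')
    · exact ((contDiffAt_const.mul hu.contDiffAt).div hw.contDiffAt
        (by rw [hw0]; exact hd'.ne')).neg
    · obtain ⟨hx, hy⟩ := hne q hq hqε
      obtain ⟨hu1, hu2, hw1, hq1⟩ := hball q hqε
      have hy1 : |q 1| ≤ 1 := (abs_apply_le_norm q 1).trans hq1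
      have hya : q 1 ^ a = q 1 ^ (a - 1) * q 1 := by rw [← pow_succ, Nat.sub_add_cancel ha]
      have hxd : q 0 ^ d = q 0 ^ (d - 1) * q 0 := by rw [← pow_succ, Nat.sub_add_cancel hd]
      have hV := hsurf q hq.1
      refine ⟨hy, ?_, -(q 0 ^ (d - 1) * w q),
        neg_ne_zero.2 (mul_ne_zero (pow_ne_zero _ hx) hw1.ne'), ?_, hgx q hx, ?_⟩
      · rw [← pow_le_pow_iff_left₀ (abs_nonneg _) (by positivity) hd.ne', mul_pow]
        have h1 := habs q hq.1 hqε
        calc |q 0| ^ d ≤ |q 0| ^ d * (2 * u q) :=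
              le_mul_of_one_le_right (by positivity) (by linarith)
          _ = 2 ^ 1 * |q 1| ^ a := by rw [h1]; ring
          _ ≤ 2 ^ d * |q 1| ^ d := by
              gcongr ?_ * ?_
              · exact pow_le_pow_right₀ (by norm_num) hd
              · exact pow_le_pow_of_le_one (abs_nonneg _) hy1 hda.le
      · rw [surfaceGrad_apply_one]
        have h1 : q 1 ^ (a - 1) * q 1 = q 0 ^ (d - 1) * q 0 * u q := by rw [← hya, ← hxd, hV]
        field_simp
        linear_combination h1
      · rw [surfaceGrad_apply_two, pow_add, hxd]
        field_simp

/-! ### The positive branch over `x > 0` -/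

/-- The positive solution `y` of `y ^ a = t ^ c * (z ^ b + t ^ e)`, with `p = 1 / a`. -/
noncomputable def branch (p : ℝ) (b c e : ℕ) (t z : ℝ) : ℝ := (t ^ c * (z ^ b + t ^ e)) ^ p

/-- The logarithmic derivative of `branch` in `t`. -/
noncomputable def logDerivT (p : ℝ) (b c e : ℕ) (t z : ℝ) : ℝ :=
  p * (c / t + e * t ^ (e - 1) / (z ^ b + t ^ e))

/-- The logarithmic derivative of `branch` in `z`. -/
noncomputable def logDerivZ (p : ℝ) (b e : ℕ) (t z : ℝ) : ℝ :=
  p * (b * z ^ (b - 1) / (z ^ b + t ^ e))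

lemma hasDerivAt_branch_t (p : ℝ) {b c e : ℕ} (hc : 0 < c) {t z : ℝ} (ht : 0 < t)
    (hf : 0 < z ^ b + t ^ e) :
    HasDerivAt (fun t => branch p b c e t z) (branch p b c e t z * logDerivT p b c e t z) t := by
  have hG : 0 < t ^ c * (z ^ b + t ^ e) := by positivity
  have h := (((hasDerivAt_pow c t).mul
    ((hasDerivAt_const t (z ^ b)).add (hasDerivAt_pow e t))).rpow_const (p := p) (Or.inl hG.ne'))
  refine h.congr_deriv ?_
  have h1 : t ^ c = t ^ (c - 1) * t := by rw [← pow_succ, Nat.sub_add_cancel hc]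
  simp only [Pi.mul_apply, Pi.add_apply, branch, logDerivT]
  rw [Real.rpow_sub_one hG.ne']
  generalize (t ^ c * (z ^ b + t ^ e)) ^ p = Y
  rw [h1]
  field_simp
  ring

lemma hasDerivAt_branch_z (p : ℝ) {b c e : ℕ} {t z : ℝ} (ht : 0 < t) (hf : 0 < z ^ b + t ^ e) :
    HasDerivAt (fun z => branch p b c e t z) (branch p b c e t z * logDerivZ p b e t z) z := by
  have hG : 0 < t ^ c * (z ^ b + t ^ e) := by positivity
  have h := (((hasDerivAt_pow b z).add_const (t ^ e)).const_mul (t ^ c)).rpow_const (p := p)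
    (Or.inl hG.ne')
  refine h.congr_deriv ?_
  simp only [branch, logDerivZ]
  rw [Real.rpow_sub_one hG.ne']
  generalize (t ^ c * (z ^ b + t ^ e)) ^ p = Y
  field_simp

lemma hasDerivAt_logDerivT_t (p : ℝ) {b c e : ℕ} {t z : ℝ} (ht : 0 < t)
    (hf : 0 < z ^ b + t ^ e) :
    HasDerivAt (fun t => logDerivT p b c e t z)
      (p * (-c / t ^ 2 + (e * ((e - 1 : ℕ) * t ^ (e - 1 - 1)) / (z ^ b + t ^ e)
        - (e * t ^ (e - 1)) ^ 2 / (z ^ b + t ^ e) ^ 2))) t := by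
  have h := (((hasDerivAt_const t (c : ℝ)).div (hasDerivAt_id t) ht.ne').add
    (((hasDerivAt_pow (e - 1) t).const_mul (e : ℝ)).div
      ((hasDerivAt_pow e t).const_add (z ^ b)) hf.ne')).const_mul p
  refine h.congr_deriv ?_
  simp only [id]
  field_simp
  ring

lemma hasDerivAt_logDerivT_z (p : ℝ) {b c e : ℕ} {t z : ℝ} (hf : 0 < z ^ b + t ^ e) :
    HasDerivAt (fun z => logDerivT p b c e t z)
      (p * (-(e * t ^ (e - 1) * (b * z ^ (b - 1))) / (z ^ b + t ^ e) ^ 2)) z := by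
  have h := (((hasDerivAt_const z ((e : ℝ) * t ^ (e - 1))).div
      ((hasDerivAt_pow b z).add_const (t ^ e)) hf.ne').const_add ((c : ℝ) / t)).const_mul p
  refine h.congr_deriv ?_
  field_simp
  ring

lemma hasDerivAt_logDerivZ_t (p : ℝ) {b e : ℕ} {t z : ℝ} (hf : 0 < z ^ b + t ^ e) :
    HasDerivAt (fun t => logDerivZ p b e t z)
      (p * (-(e * t ^ (e - 1) * (b * z ^ (b - 1))) / (z ^ b + t ^ e) ^ 2)) t := by
  have h := ((hasDerivAt_const t ((b : ℝ) * z ^ (b - 1))).div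
      ((hasDerivAt_pow e t).const_add (z ^ b)) hf.ne').const_mul p
  refine h.congr_deriv ?_
  field_simp
  ring

lemma hasDerivAt_logDerivZ_z (p : ℝ) {b e : ℕ} {t z : ℝ} (hf : 0 < z ^ b + t ^ e) :
    HasDerivAt (fun z => logDerivZ p b e t z)
      (p * (b * ((b - 1 : ℕ) * z ^ (b - 1 - 1)) / (z ^ b + t ^ e)
        - (b * z ^ (b - 1)) ^ 2 / (z ^ b + t ^ e) ^ 2)) z := by
  have h := (((hasDerivAt_pow (b - 1) z).const_mul (b : ℝ)).div
      ((hasDerivAt_pow b z).add_const (t ^ e)) hf.ne').const_mul p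
  refine h.congr_deriv ?_
  field_simp

/-- The elementary inequality behind all estimates on `branch`: monomials in `t ^ e` and `z ^ b`
are bounded by powers of `z ^ b + t ^ e`. -/
lemma pow_mul_pow_le_pow_add {f v u : ℝ} (hf1 : f ≤ 1) (hv0 : 0 ≤ v)
    (hvf : v ≤ f) (hu0 : 0 ≤ u) (huf : u ≤ f) {i k l n : ℕ} (h : n ≤ i + k + l) :
    v ^ i * f ^ k * u ^ l ≤ f ^ n := by
  have hf0 : 0 ≤ f := hv0.trans hvf
  calc v ^ i * f ^ k * u ^ l ≤ f ^ i * f ^ k * f ^ l := by gcongr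
    _ = f ^ (i + k + l) := by rw [pow_add, pow_add]
    _ ≤ f ^ n := pow_le_pow_of_le_one hf0 hf1 h

/-- The setting of the estimates: `Y` is the value of the branch at `(t, z)`, and
`f = z ^ b + t ^ e ≤ 1`. -/
structure BranchPoint (a b c e : ℕ) (t z f Y : ℝ) : Prop where
  t_pos : 0 < t
  t_le : t ≤ 1
  f_eq : f = z ^ b + t ^ e
  f_le : f ≤ 1
  Y_pos : 0 < Y
  Y_pow : Y ^ a = t ^ c * f

namespace BranchPoint

variable {a b c e : ℕ} {t z f Y : ℝ}

lemma t_pow_le (h : BranchPoint a b c e t z f Y) (hbe : Even b) : t ^ e ≤ f := by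
  rw [h.f_eq]
  linarith [hbe.pow_nonneg z]

lemma z_pow_le (h : BranchPoint a b c e t z f Y) : z ^ b ≤ f := by
  rw [h.f_eq]
  linarith [pow_pos h.t_pos e]

lemma f_pos (h : BranchPoint a b c e t z f Y) (hbe : Even b) : 0 < f :=
  (pow_pos h.t_pos e).trans_le (h.t_pow_le hbe)

lemma Y_le (h : BranchPoint a b c e t z f Y) (ha : 0 < a) (hac : a ≤ c) : Y ≤ t := by
  rw [← pow_le_pow_iff_left₀ h.Y_pos.le h.t_pos.le ha.ne', h.Y_pow]
  calc t ^ c * f ≤ t ^ c * 1 := by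
        gcongr
        · exact pow_nonneg h.t_pos.le c
        · exact h.f_le
    _ ≤ t ^ a := by
        rw [mul_one]
        exact pow_le_pow_of_le_one h.t_pos.le h.t_le hac

lemma Y_pow_mul (h : BranchPoint a b c e t z f Y) :
    Y ^ (a * b * e) = (t ^ e) ^ (c * b) * f ^ (b * e) := by
  rw [mul_assoc, pow_mul, h.Y_pow, mul_pow]
  congr 1
  rw [← pow_mul, ← pow_mul]
  congr 1
  ring

lemma abs_z_pow_mul (hbe : Even b) (k : ℕ) : (|z| ^ k) ^ (a * b * e) = (z ^ b) ^ (k * a * e) := by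
  rw [← hbe.pow_abs z, ← pow_mul, ← pow_mul]
  congr 1
  ring

/-- The first derivative in `z` is `O(t)`. -/
lemma Y_mul_abs_pow_le (h : BranchPoint a b c e t z f Y) (ha : 0 < a) (hb : 0 < b) (he : 0 < e)
    (hbe : Even b) (hac : a ≤ c) (hord : a * e + a * b ≤ (c + e) * b) :
    Y * |z| ^ (b - 1) ≤ f * t := by
  have hf := h.f_pos hbe
  have hN : a * b * e ≠ 0 := by positivity
  rw [← pow_le_pow_iff_left₀ (mul_nonneg h.Y_pos.le (by positivity))
    (mul_nonneg hf.le h.t_pos.le) hN, mul_pow, mul_pow, h.Y_pow_mul, abs_z_pow_mul hbe]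
  have hsplit : c * b = (c - a) * b + a * b := by rw [← add_mul, Nat.sub_add_cancel hac]
  have ht : t ^ (a * b * e) = (t ^ e) ^ (a * b) := by rw [← pow_mul]; congr 1; ring
  rw [hsplit, pow_add, ht]
  have hexp : a * b * e ≤ (c - a) * b + b * e + (b - 1) * a * e := by
    obtain ⟨b, rfl⟩ := Nat.exists_eq_succ_of_ne_zero hb.ne'
    obtain ⟨c, rfl⟩ := Nat.exists_eq_add_of_le hac
    simp only [Nat.succ_eq_add_one, Nat.add_sub_cancel, Nat.add_sub_cancel_left] at *
    nlinarith
  have key := pow_mul_pow_le_pow_add h.f_le (pow_pos h.t_pos e).le (h.t_pow_le hbe)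
    (hbe.pow_nonneg z) h.z_pow_le hexp
  calc _ = (t ^ e) ^ ((c - a) * b) * f ^ (b * e) * (z ^ b) ^ ((b - 1) * a * e)
        * (t ^ e) ^ (a * b) := by ring
    _ ≤ f ^ (a * b * e) * (t ^ e) ^ (a * b) :=
        mul_le_mul_of_nonneg_right key (pow_nonneg (pow_nonneg h.t_pos.le _) _)

/-- The second derivative in `z` is bounded. -/
lemma Y_mul_pow_le (h : BranchPoint a b c e t z f Y) (ha : 0 < a) (hb : 1 < b) (he : 0 < e)
    (hbe : Even b) (hord : 2 * a ≤ b ∨ 2 * (a * e) ≤ (c + e) * b) :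
    Y * |z| ^ (b - 2) ≤ f := by
  have hf := h.f_pos hbe
  have hN : a * b * e ≠ 0 := by positivity
  rw [← pow_le_pow_iff_left₀ (mul_nonneg h.Y_pos.le (by positivity)) hf.le hN, mul_pow,
    h.Y_pow_mul, abs_z_pow_mul hbe]
  have ht1 : t ^ e ≤ 1 := (h.t_pow_le hbe).trans h.f_le
  obtain ⟨b', rfl⟩ := Nat.exists_eq_add_of_le hb
  rcases hord with hord | hord
  · have hexp : a * (1 + 1 + b') * e ≤ 0 + (1 + 1 + b') * e + (1 + 1 + b' - 2) * a * e := by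
      rw [show 1 + 1 + b' - 2 = b' by omega]
      nlinarith
    refine le_trans ?_ (pow_mul_pow_le_pow_add h.f_le (pow_pos h.t_pos e).le (h.t_pow_le hbe)
      (hbe.pow_nonneg z) h.z_pow_le hexp)
    have h1 : (t ^ e) ^ (c * (1 + 1 + b')) ≤ (t ^ e) ^ 0 := by
      rw [pow_zero]
      exact pow_le_one₀ (pow_nonneg h.t_pos.le _) ht1
    exact mul_le_mul_of_nonneg_right (mul_le_mul_of_nonneg_right h1 (pow_nonneg hf.le _))
      (pow_nonneg (hbe.pow_nonneg z) _)
  · refine pow_mul_pow_le_pow_add h.f_le (pow_pos h.t_pos e).le (h.t_pow_le hbe)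
      (hbe.pow_nonneg z) h.z_pow_le ?_
    rw [show 1 + 1 + b' - 2 = b' by omega]
    nlinarith

end BranchPoint

/-! ### Estimates for the derivatives of the branch -/

namespace BranchPoint

variable {a b c e : ℕ} {t z f Y p : ℝ}

lemma abs_logDerivT_le (h : BranchPoint a b c e t z f Y) (he : 0 < e) (hbe : Even b)
    (hp0 : 0 ≤ p) (hp1 : p ≤ 1) : |logDerivT p b c e t z| ≤ (c + e) / t := by
  have hf := h.f_pos hbe
  have ht := h.t_pos
  have h1 : t ^ (e - 1) / f ≤ 1 / t := by
    rw [div_le_div_iff₀ hf ht, ← pow_succ, Nat.sub_add_cancel he, one_mul]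
    exact h.t_pow_le hbe
  rw [logDerivT, ← h.f_eq, abs_of_nonneg (by positivity)]
  calc p * (c / t + e * t ^ (e - 1) / f) ≤ 1 * (c / t + e * (1 / t)) := by
        rw [mul_div_assoc]
        gcongr
    _ = _ := by ring

lemma abs_logDerivT_t_le (h : BranchPoint a b c e t z f Y) (he : 1 < e) (hbe : Even b)
    (hp0 : 0 ≤ p) (hp1 : p ≤ 1) :
    |p * (-c / t ^ 2 + (e * ((e - 1 : ℕ) * t ^ (e - 1 - 1)) / (z ^ b + t ^ e)
        - (e * t ^ (e - 1)) ^ 2 / (z ^ b + t ^ e) ^ 2))| ≤ (c + 2 * e ^ 2) / t ^ 2 := by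
  have hf := h.f_pos hbe
  have ht := h.t_pos
  rw [← h.f_eq]
  have h1 : t ^ (e - 1) / f ≤ 1 / t := by
    rw [div_le_div_iff₀ hf ht, ← pow_succ, Nat.sub_add_cancel (by omega), one_mul]
    exact h.t_pow_le hbe
  have h2 : t ^ (e - 1 - 1) / f ≤ 1 / t ^ 2 := by
    rw [div_le_div_iff₀ hf (pow_pos ht 2), ← pow_add, show e - 1 - 1 + 2 = e by omega, one_mul]
    exact h.t_pow_le hbe
  have h3 : ((e - 1 : ℕ) : ℝ) ≤ e := by exact_mod_cast Nat.sub_le e 1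
  have e1 : (e : ℝ) * ((e - 1 : ℕ) * t ^ (e - 1 - 1)) / f ≤ e ^ 2 * (1 / t ^ 2) :=
    calc _ = e * (e - 1 : ℕ) * (t ^ (e - 1 - 1) / f) := by ring
      _ ≤ e * e * (1 / t ^ 2) := by gcongr
      _ = _ := by ring
  have e2 : (e * t ^ (e - 1)) ^ 2 / f ^ 2 ≤ e ^ 2 * (1 / t ^ 2) :=
    calc _ = (e : ℝ) ^ 2 * (t ^ (e - 1) / f) ^ 2 := by ring
      _ ≤ e ^ 2 * (1 / t) ^ 2 := by gcongr
      _ = _ := by ring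
  have e3 : 0 ≤ (e : ℝ) * ((e - 1 : ℕ) * t ^ (e - 1 - 1)) / f := by positivity
  have e4 : 0 ≤ (e * t ^ (e - 1)) ^ 2 / f ^ 2 := by positivity
  have e5 : 0 ≤ (c : ℝ) / t ^ 2 := by positivity
  rw [abs_mul, abs_of_nonneg hp0]
  refine (mul_le_of_le_one_left (abs_nonneg _) hp1).trans ?_
  have e6 : (c + 2 * e ^ 2) / t ^ 2 = c / t ^ 2 + 2 * (e ^ 2 * (1 / t ^ 2)) := by ring
  rw [e6, neg_div, abs_le]
  constructor <;> linarith

lemma abs_logDerivZ_le (h : BranchPoint a b c e t z f Y) (hbe : Even b) (hp0 : 0 ≤ p)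
    (hp1 : p ≤ 1) : |logDerivZ p b e t z| ≤ b * (|z| ^ (b - 1) / f) := by
  have hf := h.f_pos hbe
  rw [logDerivZ, ← h.f_eq, abs_mul, abs_of_nonneg hp0, abs_div, abs_mul, abs_pow, abs_of_pos hf,
    Nat.abs_cast, mul_div_assoc]
  exact mul_le_of_le_one_left (by positivity) hp1

lemma abs_mixed_le (h : BranchPoint a b c e t z f Y) (he : 0 < e) (hbe : Even b)
    (hp0 : 0 ≤ p) (hp1 : p ≤ 1) :
    |p * (-(e * t ^ (e - 1) * (b * z ^ (b - 1))) / (z ^ b + t ^ e) ^ 2)|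
      ≤ e * b * (|z| ^ (b - 1) / f) / t := by
  have hf := h.f_pos hbe
  have ht := h.t_pos
  have h1 : t ^ (e - 1) / f ≤ 1 / t := by
    rw [div_le_div_iff₀ hf ht, ← pow_succ, Nat.sub_add_cancel he, one_mul]
    exact h.t_pow_le hbe
  rw [← h.f_eq, abs_mul, abs_of_nonneg hp0, abs_div, abs_neg, abs_mul, abs_mul, abs_mul, abs_pow,
    abs_pow, abs_pow, abs_of_pos hf, abs_of_pos ht, Nat.abs_cast, Nat.abs_cast]
  calc _ ≤ e * t ^ (e - 1) * (b * |z| ^ (b - 1)) / f ^ 2 :=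
        mul_le_of_le_one_left (by positivity) hp1
    _ = e * b * (|z| ^ (b - 1) / f) * (t ^ (e - 1) / f) := by ring
    _ ≤ e * b * (|z| ^ (b - 1) / f) * (1 / t) := by gcongr
    _ = _ := by ring

lemma sq_abs_pow_le (h : BranchPoint a b c e t z f Y) (hb : 1 < b) (hbe : Even b) :
    (|z| ^ (b - 1) / f) ^ 2 ≤ |z| ^ (b - 2) / f := by
  have hf := h.f_pos hbe
  have h1 : (|z| ^ (b - 1)) ^ 2 = |z| ^ (b - 2) * z ^ b := by
    rw [← hbe.pow_abs z, ← pow_add, ← pow_mul]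
    congr 1
    omega
  rw [div_pow, h1, div_le_div_iff₀ (by positivity) hf]
  have := mul_le_mul_of_nonneg_left h.z_pow_le
    (show 0 ≤ |z| ^ (b - 2) * f by positivity)
  nlinarith

lemma abs_logDerivZ_z_le (h : BranchPoint a b c e t z f Y) (hb : 1 < b) (hbe : Even b)
    (hp0 : 0 ≤ p) (hp1 : p ≤ 1) :
    |p * (b * ((b - 1 : ℕ) * z ^ (b - 1 - 1)) / (z ^ b + t ^ e)
        - (b * z ^ (b - 1)) ^ 2 / (z ^ b + t ^ e) ^ 2)| ≤ 2 * b ^ 2 * (|z| ^ (b - 2) / f) := by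
  have hf := h.f_pos hbe
  have h3 : ((b - 1 : ℕ) : ℝ) ≤ b := by exact_mod_cast Nat.sub_le b 1
  rw [← h.f_eq, abs_mul, abs_of_nonneg hp0]
  refine (mul_le_of_le_one_left (abs_nonneg _) hp1).trans ((abs_sub _ _).trans ?_)
  rw [abs_div, abs_div, abs_mul, abs_mul, abs_pow, abs_pow (b * z ^ (b - 1)), abs_mul, abs_pow,
    abs_pow, abs_of_pos hf, Nat.abs_cast, Nat.abs_cast, show b - 1 - 1 = b - 2 by omega]
  calc _ = b * (b - 1 : ℕ) * (|z| ^ (b - 2) / f) + b ^ 2 * (|z| ^ (b - 1) / f) ^ 2 := by ring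
    _ ≤ b * b * (|z| ^ (b - 2) / f) + b ^ 2 * (|z| ^ (b - 2) / f) := by
        gcongr
        exact h.sq_abs_pow_le hb hbe
    _ = _ := by ring

end BranchPoint

/-- A constant bounding the first derivatives of the slopes of the branch. -/
def slopeBound (b c e : ℕ) : ℝ :=
  (c + e) ^ 2 + (c + 2 * e ^ 2) + b * (c + 2 * e) + 3 * b ^ 2

lemma slopeBound_nonneg (b c e : ℕ) : 0 ≤ slopeBound b c e := by
  unfold slopeBound
  positivity

namespace BranchPoint

variable {a b c e : ℕ} {t z f Y p : ℝ}

lemma abs_slopeT_t_le (h : BranchPoint a b c e t z f Y) (ha : 0 < a) (hac : a ≤ c)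
    {k k' : ℝ} (hk : |k| ≤ (c + e) / t) (hk' : |k'| ≤ (c + 2 * e ^ 2) / t ^ 2) :
    |Y * k * k + Y * k'| ≤ slopeBound b c e / t := by
  have ht := h.t_pos
  have hY := h.Y_le ha hac
  have hY0 := h.Y_pos
  refine (abs_add_le _ _).trans ?_
  rw [abs_mul, abs_mul, abs_mul, abs_of_pos hY0]
  calc Y * |k| * |k| + Y * |k'|
      ≤ t * ((c + e) / t) * ((c + e) / t) + t * ((c + 2 * e ^ 2) / t ^ 2) := by gcongr
    _ = ((c + e) ^ 2 + (c + 2 * e ^ 2)) / t := by field_simp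
    _ ≤ slopeBound b c e / t := by
        gcongr
        unfold slopeBound
        have h1 : (0 : ℝ) ≤ b * (c + 2 * e) := by positivity
        have h2 : (0 : ℝ) ≤ 3 * b ^ 2 := by positivity
        linarith

lemma abs_slope_mixed_le (h : BranchPoint a b c e t z f Y) (ha : 0 < a) (hb : 0 < b)
    (he : 0 < e) (hbe : Even b) (hac : a ≤ c) (hord : a * e + a * b ≤ (c + e) * b)
    {k m l : ℝ} (hk : |k| ≤ (c + e) / t) (hm : |m| ≤ b * (|z| ^ (b - 1) / f))
    (hl : |l| ≤ e * b * (|z| ^ (b - 1) / f) / t) :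
    |Y * k * m + Y * l| ≤ slopeBound b c e := by
  have ht := h.t_pos
  have hf := h.f_pos hbe
  have hY0 := h.Y_pos
  have hmain := h.Y_mul_abs_pow_le ha hb he hbe hac hord
  refine (abs_add_le _ _).trans ?_
  rw [abs_mul, abs_mul, abs_mul, abs_of_pos hY0]
  have h3 : Y * |z| ^ (b - 1) / (f * t) ≤ 1 := by
    rw [div_le_one (by positivity)]
    exact hmain
  calc Y * |k| * |m| + Y * |l|
      ≤ Y * ((c + e) / t) * (b * (|z| ^ (b - 1) / f))
        + Y * (e * b * (|z| ^ (b - 1) / f) / t) := by gcongr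
    _ = b * (c + 2 * e) * (Y * |z| ^ (b - 1) / (f * t)) := by field_simp; ring
    _ ≤ b * (c + 2 * e) * 1 := by gcongr
    _ ≤ slopeBound b c e := by
        unfold slopeBound
        have h1 : (0 : ℝ) ≤ (c + e) ^ 2 + (c + 2 * e ^ 2) := by positivity
        have h2 : (0 : ℝ) ≤ 3 * b ^ 2 := by positivity
        linarith

lemma abs_slopeZ_z_le (h : BranchPoint a b c e t z f Y) (ha : 0 < a) (hb : 1 < b) (he : 0 < e)
    (hbe : Even b) (hord : 2 * a ≤ b ∨ 2 * (a * e) ≤ (c + e) * b)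
    {m m' : ℝ} (hm : |m| ≤ b * (|z| ^ (b - 1) / f))
    (hm' : |m'| ≤ 2 * b ^ 2 * (|z| ^ (b - 2) / f)) :
    |Y * m * m + Y * m'| ≤ slopeBound b c e := by
  have hf := h.f_pos hbe
  have hY0 := h.Y_pos
  have hmain := h.Y_mul_pow_le ha hb he hbe hord
  refine (abs_add_le _ _).trans ?_
  rw [abs_mul, abs_mul, abs_mul, abs_of_pos hY0]
  have h3 : Y * (|z| ^ (b - 2) / f) ≤ 1 := by
    rw [← mul_div_assoc, div_le_one hf]
    exact hmain
  calc Y * |m| * |m| + Y * |m'|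
      ≤ Y * (b * (|z| ^ (b - 1) / f)) * (b * (|z| ^ (b - 1) / f))
        + Y * (2 * b ^ 2 * (|z| ^ (b - 2) / f)) := by gcongr
    _ = b ^ 2 * Y * (|z| ^ (b - 1) / f) ^ 2 + 2 * b ^ 2 * (Y * (|z| ^ (b - 2) / f)) := by ring
    _ ≤ b ^ 2 * Y * (|z| ^ (b - 2) / f) + 2 * b ^ 2 * (Y * (|z| ^ (b - 2) / f)) := by
        gcongr
        exact h.sq_abs_pow_le hb hbe
    _ = 3 * b ^ 2 * (Y * (|z| ^ (b - 2) / f)) := by ring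
    _ ≤ 3 * b ^ 2 * 1 := by gcongr
    _ ≤ slopeBound b c e := by
        unfold slopeBound
        have h1 : (0 : ℝ) ≤ (c + e) ^ 2 + (c + 2 * e ^ 2) := by positivity
        have h2 : (0 : ℝ) ≤ b * (c + 2 * e) := by positivity
        linarith

end BranchPoint

/-! ### Lipschitz estimates for the slopes of the branch -/

lemma branchPoint_branch {a b c e : ℕ} (ha : 0 < a) (hb : 0 < b) (he : 0 < e) (hbe : Even b)
    {t z : ℝ} (ht0 : 0 < t) (ht : t ≤ 1 / 2) (hz : |z| ≤ 1 / 2) :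
    BranchPoint a b c e t z (z ^ b + t ^ e) (branch ((a : ℝ)⁻¹) b c e t z) := by
  have hte : 0 < t ^ e := pow_pos ht0 e
  have hf : 0 < z ^ b + t ^ e := by linarith [hbe.pow_nonneg z]
  have hG : 0 < t ^ c * (z ^ b + t ^ e) := by positivity
  refine ⟨ht0, by linarith, rfl, ?_, Real.rpow_pos_of_pos hG _,
    Real.rpow_inv_natCast_pow hG.le ha.ne'⟩
  have h1 : t ^ e ≤ t := pow_le_of_le_one ht0.le (by linarith) he.ne'
  have h2 : |z| ^ b ≤ |z| := pow_le_of_le_one (abs_nonneg z) (by linarith) hb.ne'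
  rw [hbe.pow_abs] at h2
  linarith

lemma abs_sub_le_of_hasDerivAt {φ : ℝ → ℝ} {s t K : ℝ}
    (h : ∀ r ∈ Set.uIcc s t, ∃ l, HasDerivAt φ l r ∧ |l| ≤ K) :
    |φ s - φ t| ≤ K * |s - t| := by
  refine Convex.norm_image_sub_le_of_norm_deriv_le (𝕜 := ℝ) (f := φ)
    (fun r hr => ?_) (fun r hr => ?_) (convex_uIcc s t) Set.right_mem_uIcc Set.left_mem_uIcc
  · obtain ⟨l, hl, -⟩ := h r hr
    exact hl.differentiableAt
  · obtain ⟨l, hl, hlK⟩ := h r hr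
    rwa [hl.deriv]

/-- The slopes `branch * logDerivT` and `branch * logDerivZ` of the branch are Lipschitz at scale
`t`, respectively Lipschitz. -/
lemma branch_slopes_lipschitz {a b c e : ℕ} (ha : 0 < a) (hb : 1 < b) (he : 1 < e) (hbe : Even b)
    (hac : a ≤ c) (hord : a * e + a * b ≤ (c + e) * b)
    (hord' : 2 * a ≤ b ∨ 2 * (a * e) ≤ (c + e) * b) {t t' z z' : ℝ} (ht0 : 0 < t)
    (ht : t ≤ 1 / 2) (ht0' : t / 4 ≤ t') (ht' : t' ≤ 1 / 2) (hz : |z| ≤ 1 / 2)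
    (hz' : |z'| ≤ 1 / 2) :
    t * |branch (a : ℝ)⁻¹ b c e t z * logDerivT (a : ℝ)⁻¹ b c e t z
        - branch (a : ℝ)⁻¹ b c e t' z' * logDerivT (a : ℝ)⁻¹ b c e t' z'|
      ≤ 4 * slopeBound b c e * (|t - t'| + |z - z'|) ∧
    |branch (a : ℝ)⁻¹ b c e t z * logDerivZ (a : ℝ)⁻¹ b e t z
        - branch (a : ℝ)⁻¹ b c e t' z' * logDerivZ (a : ℝ)⁻¹ b e t' z'|
      ≤ slopeBound b c e * (|t - t'| + |z - z'|) := by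
  have hb0 : 0 < b := by omega
  have he0 : 0 < e := by omega
  have hc0 : 0 < c := by omega
  have hp0 : (0 : ℝ) ≤ (a : ℝ)⁻¹ := by positivity
  have hp1 : (a : ℝ)⁻¹ ≤ 1 := inv_le_one_of_one_le₀ (by exact_mod_cast ha)
  have hK := slopeBound_nonneg b c e
  have hBP := fun {t z : ℝ} => branchPoint_branch (t := t) (z := z) (c := c) ha hb0 he0 hbe
  generalize (a : ℝ)⁻¹ = p at *
  have htr : ∀ r ∈ Set.uIcc t t', t / 4 ≤ r ∧ r ≤ 1 / 2 := by
    intro r hr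
    rw [Set.mem_uIcc] at hr
    rcases hr with hr | hr <;> constructor <;> linarith
  have hzr : ∀ r ∈ Set.uIcc z z', |r| ≤ 1 / 2 := by
    intro r hr
    rw [Set.mem_uIcc] at hr
    rw [abs_le] at hz hz' ⊢
    rcases hr with hr | hr <;> constructor <;> linarith
  have ht'0 : 0 < t' := by linarith
  have h1 : |branch p b c e t z * logDerivT p b c e t z
      - branch p b c e t' z * logDerivT p b c e t' z|
      ≤ slopeBound b c e / (t / 4) * |t - t'| := by
    refine abs_sub_le_of_hasDerivAt (φ := fun t => branch p b c e t z * logDerivT p b c e t z)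
      fun r hr => ?_
    obtain ⟨hr1, hr2⟩ := htr r hr
    have hr0 : 0 < r := by linarith
    have B := hBP hr0 hr2 hz
    have hf := B.f_pos hbe
    refine ⟨_, (hasDerivAt_branch_t p hc0 hr0 hf).mul (hasDerivAt_logDerivT_t p hr0 hf), ?_⟩
    refine (B.abs_slopeT_t_le ha hac (B.abs_logDerivT_le he0 hbe hp0 hp1)
      (B.abs_logDerivT_t_le he hbe hp0 hp1)).trans ?_
    gcongr
  have h2 : |branch p b c e t' z * logDerivT p b c e t' z
      - branch p b c e t' z' * logDerivT p b c e t' z'| ≤ slopeBound b c e * |z - z'| := by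
    refine abs_sub_le_of_hasDerivAt (φ := fun z => branch p b c e t' z * logDerivT p b c e t' z)
      fun r hr => ?_
    have B := hBP ht'0 ht' (hzr r hr)
    have hf := B.f_pos hbe
    refine ⟨_, (hasDerivAt_branch_z p ht'0 hf).mul (hasDerivAt_logDerivT_z p hf), ?_⟩
    rw [mul_right_comm]
    exact B.abs_slope_mixed_le ha hb0 he0 hbe hac hord (B.abs_logDerivT_le he0 hbe hp0 hp1)
      (B.abs_logDerivZ_le hbe hp0 hp1) (B.abs_mixed_le he0 hbe hp0 hp1)
  have h3 : |branch p b c e t z * logDerivZ p b e t z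
      - branch p b c e t' z * logDerivZ p b e t' z| ≤ slopeBound b c e * |t - t'| := by
    refine abs_sub_le_of_hasDerivAt (φ := fun t => branch p b c e t z * logDerivZ p b e t z)
      fun r hr => ?_
    obtain ⟨hr1, hr2⟩ := htr r hr
    have hr0 : 0 < r := by linarith
    have B := hBP hr0 hr2 hz
    have hf := B.f_pos hbe
    refine ⟨_, (hasDerivAt_branch_t p hc0 hr0 hf).mul (hasDerivAt_logDerivZ_t p hf), ?_⟩
    exact B.abs_slope_mixed_le ha hb0 he0 hbe hac hord (B.abs_logDerivT_le he0 hbe hp0 hp1)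
      (B.abs_logDerivZ_le hbe hp0 hp1) (B.abs_mixed_le he0 hbe hp0 hp1)
  have h4 : |branch p b c e t' z * logDerivZ p b e t' z
      - branch p b c e t' z' * logDerivZ p b e t' z'| ≤ slopeBound b c e * |z - z'| := by
    refine abs_sub_le_of_hasDerivAt (φ := fun z => branch p b c e t' z * logDerivZ p b e t' z)
      fun r hr => ?_
    have B := hBP ht'0 ht' (hzr r hr)
    have hf := B.f_pos hbe
    refine ⟨_, (hasDerivAt_branch_z p ht'0 hf).mul (hasDerivAt_logDerivZ_z p hf), ?_⟩
    exact B.abs_slopeZ_z_le ha hb he0 hbe hord' (B.abs_logDerivZ_le hbe hp0 hp1)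
      (B.abs_logDerivZ_z_le hb hbe hp0 hp1)
  constructor
  · have h5 := mul_le_mul_of_nonneg_left ((abs_sub_le _ _ _).trans (add_le_add h1 h2)) ht0.le
    refine h5.trans ?_
    have h6 : t * (slopeBound b c e / (t / 4) * |t - t'| + slopeBound b c e * |z - z'|)
        = 4 * slopeBound b c e * |t - t'| + t * (slopeBound b c e * |z - z'|) := by
      field_simp
    have h7 : t * (slopeBound b c e * |z - z'|) ≤ 4 * (slopeBound b c e * |z - z'|) :=
      mul_le_mul_of_nonneg_right (by linarith) (by positivity)
    rw [h6]
    linarith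
  · refine ((abs_sub_le _ _ _).trans (add_le_add h3 h4)).trans ?_
    linarith

lemma abs_mul_sub_mul_of_mul_pos {u u' : ℝ} (h : 0 < u * u') (m m' : ℝ) :
    |u * m - u' * m'| = |(|u| * m - |u'| * m')| := by
  rcases pos_and_pos_or_neg_and_neg_of_mul_pos h with ⟨h1, h2⟩ | ⟨h1, h2⟩
  · rw [abs_of_pos h1, abs_of_pos h2]
  · rw [abs_of_neg h1, abs_of_neg h2, ← abs_neg]
    congr 1
    ring

/-- For odd `a ≤ c` and even `b`, `e = d - c`, the surface is the graph of a function of `(x, z)`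
whose slopes are controlled by `branch_slopes_lipschitz`. -/
theorem mostowskiRegular_of_branch {γ : ℝ} (hγ : 1 < γ) {a b c e : ℕ} (ha : Odd a) (hb : 0 < b)
    (he : 0 < e) (hbe : Even b) (hee : Even e) (hac : a ≤ c)
    (hord : a * e + a * b ≤ (c + e) * b)
    (hord' : 2 * a ≤ b ∨ 2 * (a * e) ≤ (c + e) * b) : MostowskiRegular γ a b c (c + e) := by
  have ha0 : 0 < a := ha.pos
  have hb1 : 1 < b := by obtain ⟨k, rfl⟩ := hbe; omega
  have he1 : 1 < e := by obtain ⟨k, rfl⟩ := hee; omega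
  have hc0 : 0 < c := by omega
  have ha' : (0 : ℝ) < a := by exact_mod_cast ha0
  have hK := slopeBound_nonneg b c e
  let kT : EuclideanSpace ℝ (Fin 3) → ℝ := fun q => logDerivT (a : ℝ)⁻¹ b c e |q 0| (q 2)
  let kZ : EuclideanSpace ℝ (Fin 3) → ℝ := fun q => logDerivZ (a : ℝ)⁻¹ b e |q 0| (q 2)
  let ν : EuclideanSpace ℝ (Fin 3) → EuclideanSpace ℝ (Fin 3) := fun q =>
    !₂[-(q 1 * kT q * (|q 0| / q 0)), 1, -(q 1 * kZ q)]
  have hν0 : ∀ q, ν q 0 = -(q 1 * kT q * (|q 0| / q 0)) := fun q => rfl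
  have hν1 : ∀ q, ν q 1 = 1 := fun q => rfl
  have hν2 : ∀ q, ν q 2 = -(q 1 * kZ q) := fun q => rfl
  have hpt : ∀ q ∈ surfaceV a b c (c + e) \ axisOz, ‖q‖ < 1 / 2 → q 0 ≠ 0 ∧
      q 1 ^ a = q 0 ^ c * (q 2 ^ b + |q 0| ^ e) ∧ |q 0| ≤ 1 / 2 ∧ |q 2| ≤ 1 / 2 ∧
      |q 1| = branch (a : ℝ)⁻¹ b c e |q 0| (q 2) ∧
      BranchPoint a b c e |q 0| (q 2) (q 2 ^ b + |q 0| ^ e) |q 1| := by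
    intro q hq hqε
    have hV : q 1 ^ a = q 0 ^ c * (q 2 ^ b + |q 0| ^ e) := by
      rw [hee.pow_abs, show q 1 ^ a = q 2 ^ b * q 0 ^ c + q 0 ^ (c + e) from hq.1]
      ring
    have hx : q 0 ≠ 0 := by
      intro h
      rw [h, zero_pow hc0.ne', zero_mul] at hV
      exact hq.2 ⟨h, (pow_eq_zero_iff ha0.ne').1 hV⟩
    have h0 : |q 0| ≤ 1 / 2 := (abs_apply_le_norm q 0).trans hqε.le
    have h2 : |q 2| ≤ 1 / 2 := (abs_apply_le_norm q 2).trans hqε.le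
    have hf : 0 ≤ q 2 ^ b + |q 0| ^ e := add_nonneg (hbe.pow_nonneg _) (by positivity)
    have hY : |q 1| = branch (a : ℝ)⁻¹ b c e |q 0| (q 2) := by
      have : |q 1| ^ a = |q 0| ^ c * (q 2 ^ b + |q 0| ^ e) := by
        rw [← abs_pow, hV, abs_mul, abs_pow, abs_of_nonneg hf]
      rw [branch, ← this, Real.pow_rpow_inv_natCast (abs_nonneg _) ha0.ne']
    refine ⟨hx, hV, h0, h2, hY, ?_⟩
    rw [hY]
    exact branchPoint_branch ha0 hb he hbe (abs_pos.2 hx) h0 h2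
  refine mostowskiRegular_of_normalField hγ ha0 hc0 (by omega) (ε := 1 / 2)
    (K := b + 20 * slopeBound b c e) (by norm_num) (by positivity) ν fun q hq hqε => ?_
  obtain ⟨hx, hV, hx1, hz1, hY, B⟩ := hpt q hq hqε
  have hf := B.f_pos hbe
  have hy : q 1 ≠ 0 := abs_pos.1 B.Y_pos
  have ht := B.t_pos
  have hp0 : (0 : ℝ) ≤ (a : ℝ)⁻¹ := by positivity
  have hp1 : (a : ℝ)⁻¹ ≤ 1 := inv_le_one_of_one_le₀ (by exact_mod_cast ha0)
  have hyx : |q 1| ≤ |q 0| := B.Y_le ha0 hac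
  have hρ : axisDist q ≤ 3 / 2 * |q 0| := by
    rw [← sq_le_sq₀ (axisDist_nonneg q) (by positivity), axisDist_sq, mul_pow, sq_abs]
    have : q 1 ^ 2 ≤ q 0 ^ 2 := sq_le_sq.2 hyx
    nlinarith [sq_nonneg (q 0)]
  refine ⟨⟨a * q 1 ^ (a - 1), mul_ne_zero ha'.ne' (pow_ne_zero _ hy), ?_⟩, ?_, ?_,
    fun q' hq' hq'ε hqq' => ?_⟩
  · have hya : q 1 ^ (a - 1) * q 1 = q 0 ^ c * (q 2 ^ b + |q 0| ^ e) := by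
      rw [← pow_succ, Nat.sub_add_cancel ha0, hV]
    have hxc : q 0 ^ c = q 0 ^ (c - 1) * q 0 := by rw [← pow_succ, Nat.sub_add_cancel hc0]
    have hte : |q 0| ^ (e - 1) * |q 0| = q 0 ^ e := by
      rw [← pow_succ, Nat.sub_add_cancel he, hee.pow_abs]
    have key : ∀ i : Fin 3, surfaceGrad a b c (c + e) q i = a * q 1 ^ (a - 1) * ν q i := by
      intro i
      fin_cases i
      · change surfaceGrad a b c (c + e) q 0 = a * q 1 ^ (a - 1) * ν q 0
        rw [surfaceGrad_apply_zero, hν0]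
        have h1 : a * q 1 ^ (a - 1) * -(q 1 * kT q * (|q 0| / q 0))
            = -((q 1 ^ (a - 1) * q 1) * (c + e * (|q 0| ^ (e - 1) * |q 0|)
              / (q 2 ^ b + |q 0| ^ e)) / q 0) := by
          simp only [kT, logDerivT]
          field_simp
        rw [h1, hya, hte, hxc, hee.pow_abs, show c + e - 1 = c - 1 + e by omega, pow_add]
        have hf' : q 2 ^ b + q 0 ^ e ≠ 0 := by rw [← hee.pow_abs]; exact hf.ne'
        push_cast
        field_simp
        ring
      · change surfaceGrad a b c (c + e) q 1 = a * q 1 ^ (a - 1) * ν q 1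
        rw [surfaceGrad_apply_one, hν1, mul_one]
      · change surfaceGrad a b c (c + e) q 2 = a * q 1 ^ (a - 1) * ν q 2
        rw [surfaceGrad_apply_two, hν2]
        have h1 : a * q 1 ^ (a - 1) * -(q 1 * kZ q)
            = -((q 1 ^ (a - 1) * q 1) * (b * q 2 ^ (b - 1)) / (q 2 ^ b + |q 0| ^ e)) := by
          simp only [kZ, logDerivZ]
          field_simp
        rw [h1, hya]
        field_simp
    ext i
    exact key i
  · refine le_trans ?_ (abs_apply_le_norm _ 1)
    rw [hν1, abs_one]
  · have hm := B.abs_logDerivZ_le hbe hp0 hp1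
    have hmain := B.Y_mul_abs_pow_le ha0 hb he hbe hac hord
    rw [hν2, abs_neg, abs_mul]
    calc |q 1| * |kZ q|
        ≤ |q 1| * (b * (|q 2| ^ (b - 1) / (q 2 ^ b + |q 0| ^ e))) := by gcongr
      _ = b * (|q 1| * |q 2| ^ (b - 1) / (q 2 ^ b + |q 0| ^ e)) := by ring
      _ ≤ b * |q 0| := by
          gcongr
          rw [div_le_iff₀ hf, mul_comm |q 0|]
          exact hmain
      _ ≤ b * axisDist q := by gcongr; exact abs_zero_le_axisDist q
      _ ≤ (b + 20 * slopeBound b c e) * axisDist q := by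
          gcongr
          · exact axisDist_nonneg q
          · linarith
  · obtain ⟨hx', hV', hx1', hz1', hY', B'⟩ := hpt q' hq' hq'ε
    set D := ‖q - q'‖ with hD
    have hdx : |q 0 - q' 0| ≤ D := abs_apply_le_norm (q - q') 0
    have hdz : |q 2 - q' 2| ≤ D := abs_apply_le_norm (q - q') 2
    have hclose : |q 0 - q' 0| ≤ 3 / 4 * |q 0| := by linarith
    have hxx : 0 < q 0 * q' 0 := by
      rcases lt_or_gt_of_ne hx with h | h
      · rw [abs_of_neg h, abs_le] at hclose
        exact mul_pos_of_neg_of_neg h (by linarith)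
      · rw [abs_of_pos h, abs_le] at hclose
        exact mul_pos h (by linarith)
    have hyy : 0 < q 1 * q' 1 := by
      rw [← ha.pow_pos_iff, mul_pow, hV, hV',
        show q 0 ^ c * (q 2 ^ b + |q 0| ^ e) * (q' 0 ^ c * (q' 2 ^ b + |q' 0| ^ e))
          = (q 0 * q' 0) ^ c * ((q 2 ^ b + |q 0| ^ e) * (q' 2 ^ b + |q' 0| ^ e)) by ring]
      exact mul_pos (pow_pos hxx c) (mul_pos hf (B'.f_pos hbe))
    have hdt : |(|q 0| - |q' 0|)| ≤ |q 0 - q' 0| := abs_abs_sub_abs_le_abs_sub _ _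
    have ht' : |q 0| / 4 ≤ |q' 0| := by
      have := (abs_le.1 (hdt.trans hclose)).2
      linarith
    have hsgn : |q 0| / q 0 = |q' 0| / q' 0 := by
      rcases pos_and_pos_or_neg_and_neg_of_mul_pos hxx with ⟨h1, h2⟩ | ⟨h1, h2⟩
      · rw [abs_of_pos h1, abs_of_pos h2, div_self hx, div_self hx']
      · rw [abs_of_neg h1, abs_of_neg h2, neg_div, neg_div, div_self hx, div_self hx']
    have hsgn1 : |(|q' 0| / q' 0)| = 1 := by
      rw [abs_div, abs_abs, div_self (abs_ne_zero.2 hx')]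
    obtain ⟨L1, L2⟩ := branch_slopes_lipschitz ha0 hb1 he1 hbe hac hord hord' ht hx1 ht' hx1'
      hz1 hz1'
    rw [← hY, ← hY', ← abs_mul_sub_mul_of_mul_pos hyy] at L1 L2
    have hsum : |(|q 0| - |q' 0|)| + |q 2 - q' 2| ≤ 2 * D := by linarith
    have E0 : |ν q 0 - ν q' 0| = |q 1 * kT q - q' 1 * kT q'| := by
      rw [hν0, hν0, hsgn, neg_sub_neg, ← sub_mul, abs_mul, hsgn1, mul_one, abs_sub_comm]
    have E2 : |ν q 2 - ν q' 2| = |q 1 * kZ q - q' 1 * kZ q'| := by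
      rw [hν2, hν2, neg_sub_neg, abs_sub_comm]
    have F0 : |q 0| * |ν q 0 - ν q' 0| ≤ 8 * slopeBound b c e * D := by
      rw [E0]
      refine L1.trans ((mul_le_mul_of_nonneg_left hsum (by positivity)).trans ?_)
      linarith
    have F2 : |ν q 2 - ν q' 2| ≤ 2 * slopeBound b c e * D := by
      rw [E2]
      refine L2.trans ((mul_le_mul_of_nonneg_left hsum hK).trans ?_)
      linarith
    have hD0 : 0 ≤ D := norm_nonneg _
    have hbD : 0 ≤ b * D := by positivity
    have hKD : 0 ≤ slopeBound b c e * D := by positivity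
    refine ⟨?_, F2.trans ?_⟩
    · have hn : ‖ν q - ν q'‖ ≤ |ν q 0 - ν q' 0| + |ν q 2 - ν q' 2| := by
        refine (norm_le_abs_add_abs_add_abs _).trans (le_of_eq ?_)
        simp only [PiLp.sub_apply, hν1, sub_self, abs_zero, add_zero]
      calc axisDist q * ‖ν q - ν q'‖
          ≤ 3 / 2 * |q 0| * (|ν q 0 - ν q' 0| + |ν q 2 - ν q' 2|) := by gcongr
        _ = 3 / 2 * (|q 0| * |ν q 0 - ν q' 0|) + 3 / 2 * (|q 0| * |ν q 2 - ν q' 2|) := by ring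
        _ ≤ 3 / 2 * (8 * slopeBound b c e * D) + 3 / 2 * (1 * (2 * slopeBound b c e * D)) := by
            gcongr
            linarith
        _ ≤ _ := by linarith
    · linarith

/-! ### The classification -/

theorem mainTheorem3 (γ : ℝ) (hγ : 1 < γ) (a b c d : ℕ)
    (ha : 0 < a) (hb : 0 < b) (hc : 0 < c) (hd : 0 < d) :
    (a = 1 → MostowskiRegular γ a b c d) ∧
    (1 < a →
      (d ≤ c → MostowskiRegular γ a b c d) ∧
      (c < d →
        (Odd b → ¬ MostowskiRegular γ a b c d) ∧
        (Even b →
          (d ≡ c + 1 [MOD 2] → ¬ MostowskiRegular γ a b c d) ∧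
          (d ≡ c [MOD 2] →
            ((b : ℤ) * |(d : ℤ) - a| < a * ((d : ℤ) - c) → ¬ MostowskiRegular γ a b c d) ∧
            ((a : ℤ) * ((d : ℤ) - c) ≤ b * |(d : ℤ) - a| →
              (d < a →
                (Even d ∧ Even c → ¬ MostowskiRegular γ a b c d) ∧
                (Odd d ∧ Odd c →
                  ((b : ℤ) < 2 * ((d : ℤ) - c) → ¬ MostowskiRegular γ a b c d))) ∧
              (a ≤ d →
                (Even a → ¬ MostowskiRegular γ a b c d) ∧
                (Odd a →
                  (c < a → ¬ MostowskiRegular γ a b c d) ∧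
                  (a ≤ c →
                    (b < a →
                      ((a : ℤ) * ((d : ℤ) - c) ≤ (d : ℤ) - a → MostowskiRegular γ a b c d) ∧
                      ((d : ℤ) - a < (a : ℤ) * ((d : ℤ) - c) →
                        ((d : ℤ) * b < 2 * a * ((d : ℤ) - c) →
                          ¬ MostowskiRegular γ a b c d))) ∧
                    (a ≤ b →
                      (2 * a ≤ b → MostowskiRegular γ a b c d) ∧
                      (b < 2 * a →
                        ((a : ℤ) * ((d : ℤ) - c) ≤ d → MostowskiRegular γ a b c d) ∧
                        ((d : ℤ) < (a : ℤ) * ((d : ℤ) - c) →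
                          ((d : ℤ) * b < 2 * a * ((d : ℤ) - c) →
                            ¬ MostowskiRegular γ a b c d)))))))))))) := by
  refine ⟨?_, fun ha1 => ⟨fun hdc => mostowskiRegular_of_cusp hγ ha hb hd hdc, fun hcd => ?_⟩⟩
  · rintro rfl
    exact mostowskiRegular_of_graph hγ hc hd
  obtain ⟨e, rfl⟩ := Nat.exists_eq_add_of_lt hcd
  have hd_eq : c + e + 1 = c + (e + 1) := by ring
  rw [hd_eq] at *
  generalize he' : e + 1 = e at *
  have he : 0 < e := by omega
  refine ⟨fun hbo => ?_, fun hbe => ⟨fun hdc => ?_, fun hdc => ?_⟩⟩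
  · exact not_mostowskiRegular_of_zeroCurve hγ ha1 hb hc he (σ := 1) (τ := -1) (by simp) (by simp)
      (by rw [hbo.neg_one_pow, one_pow])
  · have heo : Odd e := by
      have : e ≡ 1 [MOD 2] := Nat.ModEq.add_left_cancel' c hdc
      exact Nat.odd_iff.2 this
    exact not_mostowskiRegular_of_zeroCurve hγ ha1 hb hc he (σ := -1) (τ := 1) (by simp) (by simp)
      (by rw [heo.neg_one_pow, one_pow, neg_neg])
  · have hee : Even e := by
      have : e ≡ 0 [MOD 2] := Nat.ModEq.add_left_cancel' c (by simpa using hdc)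
      exact Nat.even_iff.2 this
    have hb1 : 1 < b := by obtain ⟨k, rfl⟩ := hbe; omega
    push_cast
    rw [add_sub_cancel_left]
    refine ⟨fun h => ?_, fun h => ⟨fun hda => ?_, fun had => ?_⟩⟩
    · have h1 : (b : ℤ) * ((c : ℤ) + e - a) < a * e :=
        (mul_le_mul_of_nonneg_left (le_abs_self _) (by positivity)).trans_lt h
      have h2 : (b : ℤ) * -((c : ℤ) + e - a) < a * e :=
        (mul_le_mul_of_nonneg_left (neg_le_abs _) (by positivity)).trans_lt h
      refine not_mostowskiRegular_of_curve hγ ha hb hc he ?_ ?_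
      · zify
        linarith
      · zify
        linarith
    · have hord : a * e + (c + e) * b ≤ a * b := by
        rw [abs_of_neg (by have : ((c + e : ℕ) : ℤ) < a := by exact_mod_cast hda
                           push_cast at this
                           linarith)] at h
        zify
        linarith
      refine ⟨fun hpar => not_mostowskiRegular_of_even_x hγ ha hb hc he hord hpar.2 hee,
        fun _ hbe' => not_mostowskiRegular_of_zSection_x hγ ha hb1 hc he hord ?_⟩
      exact_mod_cast hbe'
    · have hord : a * e + a * b ≤ (c + e) * b := by
        rw [abs_of_nonneg (by have : (a : ℤ) ≤ ((c + e : ℕ) : ℤ) := by exact_mod_cast had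
                              push_cast at this
                              linarith)] at h
        zify
        linarith
      have hsec : ((c : ℤ) + e) * b < 2 * a * e → ¬ MostowskiRegular γ a b c (c + e) := by
        intro h1
        refine not_mostowskiRegular_of_zSection_y hγ ha hb1 hc he hord ?_
        zify
        linarith
      refine ⟨fun hae => not_mostowskiRegular_of_even_y hγ ha hb hc he hord hae, fun hao =>
        ⟨fun hca => ?_, fun hac => ?_⟩⟩
      · refine not_mostowskiRegular_of_diagonal hγ hb hc hca ?_
        have h1 : 0 < a * e := by positivity
        by_contra h2
        have h3 := Nat.mul_le_mul_right b (not_lt.1 h2)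
        omega
      · have hpos := fun h' => mostowskiRegular_of_branch hγ hao hb he hbe hee hac hord h'
        refine ⟨fun hba => ⟨fun h1 => hpos (Or.inr ?_), fun _ => hsec⟩,
          fun hab => ⟨fun h1 => hpos (Or.inl h1), fun hb2 =>
            ⟨fun h1 => hpos (Or.inr ?_), fun _ => hsec⟩⟩⟩
        -- as `2 ≤ b`, the bound on `a * e` by `d - a`, and the one by `d`, give `2 * a * e ≤ b * d`
        · have h2 : a * e ≤ c + e := by
            zify
            linarith [show (0 : ℤ) ≤ a by positivity]
          nlinarith
        · have h2 : a * e ≤ c + e := by exact_mod_cast h1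
          nlinarith
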